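/- Let $n\ge 1$ and let $B=(b_{ij})$ be a skew-symmetrizable integer $n\times n$ matrix. Write $[b]_+=\max(b,0)$. Let $\mathbb{P}=\mathrm{Trop}(y_1,\dots,y_n)$ be the tropical semifield, i.e. the free multiplicative abelian group on $y_1,\dots,y_n$ with $\prod_i y_i^{a_i}\oplus\prod_i y_i^{b_i}=\prod_i y_i^{\min(a_i,b_i)}$, and let $\mathcal F=\mathbb{Q}\mathbb{P}(x_1,\dots,x_n)$, where $\mathbb{Q}\mathbb{P}$ is the field of fractions of the group ring $\mathbb{Z}\mathbb{P}$. Mutation of a labeled seed $(\mathbf x,\mathbf y,B)$ in direction $k$ gives $(\mathbf x',\mathbf y',B')$ with $x_i'=x_i$ for $i\ne k$, $$x_k'=x_k^{-1}\Big(\tfrac{y_k}{1\oplus y_k}\prod_j x_j^{[b_{jk}]_+}+\tfrac{1}{1\oplus y_k}\prod_j x_j^{[-b_{jk}]_+}\Big),$$ $y_k'=y_k^{-1}$, $y_i'=y_iy_k^{[b_{ki}]_+}(1\oplus y_k)^{-b_{ki}}$ for $i\neq k$, and $b_{ij}'=-b_{ij}$ if $i=k$ or $j=k$, $b'_{ij}=b_{ij}+[b_{ik}]_+b_{kj}+b_{ik}[-b_{kj}]_+$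 otherwise. The cluster pattern with principal coefficients and initial exchange matrix $B$ assigns to each vertex $t$ of the $n$-regular tree $\mathbb{T}_n$ the seed $(\mathbf x_t,\mathbf y_t,B_t)$ obtained from the initial seed $((x_1,\dots,x_n),(y_1,\dots,y_n),B)$ at $t_0$ by mutating along the labels of the path from $t_0$ to $t$. Assume that it is of type $A_n$: for some vertex $t$ the Cartan counterpart of $B_t$ (diagonal entries $2$, off-diagonal entries $-|b_{ij;t}|$) is, up to a simultaneous permutation of rows and columns, the Cartan matrix of type $A_n$. Then for every vertex $t$ and every $i\in\{1,\dots,n\}$ the $F$-polynomial $$F_{i;t}(y_1,\dots,y_n)=x_{i;t}\big|_{x_1=\cdots=x_n=1}$$ is a well-defined element of $\mathbb{Z}[y_1,\dots,y_n]$, its degree in each variable $y_j$ is at most $1$, and it is log-concave: it is nonzero, it has non-negative coefficients, and its coefficients $a_{i_1,\dots,i_n}$ satisfy $$a_{i_1,\dots,i_j,\dots,i_n}^2\ \ge\ a_{i_1,\dots,i_j-1,\dots,i_n}\,a_{i_1,\dots,i_j+1,\dots,i_n}$$ for all $j$ and all exponents, where coefficients at negative exponents are $0$. -/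

import Mathlib

noncomputable section

namespace Cluster

/-- The multiplicative group of the tropical semifield `Trop(y_1, …, y_n)`: Laurent monomials in
`y_1, …, y_n`, each given by its vector of exponents. -/
abbrev Trop (n : ℕ) : Type := Multiplicative (Fin n → ℤ)

/-- The generator `y_i` of `Trop(y_1, …, y_n)`. -/
def Trop.gen {n : ℕ} (i : Fin n) : Trop n := Multiplicative.ofAdd (Pi.single i 1)

/-- The addition `⊕` of the tropical semifield: componentwise minimum of exponents. -/
def Trop.oplus {n : ℕ} (a b : Trop n) : Trop n :=
  Multiplicative.ofAdd fun i => min (Multiplicative.toAdd a i) (Multiplicative.toAdd b i)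

/-- `ℚℙ`, the field of fractions of the group ring `ℤℙ = ℤ[y_1^{±1}, …, y_n^{±1}]` of
`ℙ = Trop(y_1, …, y_n)`; it is the field of fractions of `ℤ[y_1, …, y_n]`. -/
abbrev CoeffField (n : ℕ) : Type := FractionRing (MvPolynomial (Fin n) ℤ)

/-- The ambient field: rational functions in `x_1, …, x_n` over `ℚℙ`. -/
abbrev AmbientField (n : ℕ) : Type := FractionRing (MvPolynomial (Fin n) (CoeffField n))

/-- A Laurent monomial in `y_1, …, y_n` as an element of `ℚℙ`. -/
def Trop.toCoeff {n : ℕ} (a : Trop n) : CoeffField n :=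
  ∏ i, algebraMap (MvPolynomial (Fin n) ℤ) (CoeffField n) (MvPolynomial.X i) ^
    Multiplicative.toAdd a i

/-- A Laurent monomial in `y_1, …, y_n` as an element of the ambient field. -/
def Trop.toAmbient {n : ℕ} (a : Trop n) : AmbientField n :=
  algebraMap (MvPolynomial (Fin n) (CoeffField n)) (AmbientField n) (MvPolynomial.C a.toCoeff)

/-- The data `(x, y, B)` of a labeled seed over `Trop(y_1, …, y_n)`. -/
structure Seed (n : ℕ) where
  x : Fin n → AmbientField n
  y : Fin n → Trop n
  B : Matrix (Fin n) (Fin n) ℤ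

/-- Mutation of the matrix `B` in direction `k`, with `[b]_+ = max b 0`. -/
def mutateMatrix {n : ℕ} (k : Fin n) (B : Matrix (Fin n) (Fin n) ℤ) :
    Matrix (Fin n) (Fin n) ℤ :=
  Matrix.of fun i j =>
    if i = k ∨ j = k then - B i j
    else B i j + max (B i k) 0 * B k j + B i k * max (- B k j) 0

/-- Seed mutation in direction `k`. -/
def Seed.mutate {n : ℕ} (k : Fin n) (s : Seed n) : Seed n where
  x := fun i =>
    if i = k then
      (s.x k)⁻¹ *
        (Trop.toAmbient (s.y k / Trop.oplus 1 (s.y k)) * ∏ j, s.x j ^ max (s.B j k) 0 +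
          Trop.toAmbient (1 / Trop.oplus 1 (s.y k)) * ∏ j, s.x j ^ max (- s.B j k) 0)
    else s.x i
  y := fun i =>
    if i = k then (s.y k)⁻¹
    else s.y i * s.y k ^ max (s.B k i) 0 * (Trop.oplus 1 (s.y k)) ^ (- s.B k i)
  B := mutateMatrix k s.B

/-- The initial seed with principal coefficients: `x_i` are the indeterminates of the ambient
field and `y_i` are the generators of the tropical semifield. -/
def initialSeed {n : ℕ} (B : Matrix (Fin n) (Fin n) ℤ) : Seed n where
  x := fun i => algebraMap (MvPolynomial (Fin n) (CoeffField n)) (AmbientField n)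
    (MvPolynomial.X i)
  y := Trop.gen
  B := B

/-- The seed `(x_t, y_t, B_t)` at the vertex `t` of the `n`-regular tree that is reached from `t_0`
by following the edges labeled by the successive entries of `w`. Every vertex is reached in this
way. -/
def seedAt {n : ℕ} (B : Matrix (Fin n) (Fin n) ℤ) (w : List (Fin n)) : Seed n :=
  w.foldl (fun s k => s.mutate k) (initialSeed B)

/-- `DB` is skew-symmetric for some diagonal matrix `D` with positive integer diagonal entries. -/
def IsSkewSymmetrizable {n : ℕ} (B : Matrix (Fin n) (Fin n) ℤ) : Prop :=
  ∃ d : Fin n → ℤ, (∀ i, 0 < d i) ∧ ∀ i j, d i * B i j = - (d j * B j i)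

/-- The Cartan counterpart `A(B)`. -/
def cartanCounterpart {n : ℕ} (B : Matrix (Fin n) (Fin n) ℤ) : Matrix (Fin n) (Fin n) ℤ :=
  Matrix.of fun i j => if i = j then 2 else - |B i j|

/-- The cluster algebra with initial exchange matrix `B` is of type `A_n`: some exchange matrix
of its cluster pattern has as Cartan counterpart the Cartan matrix of type `A_n`, up to a
relabeling of the indices. -/
def IsTypeA {n : ℕ} (B : Matrix (Fin n) (Fin n) ℤ) : Prop :=
  ∃ (w : List (Fin n)) (σ : Equiv.Perm (Fin n)),
    (cartanCounterpart (seedAt B w).B).submatrix σ σ = CartanMatrix.A n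

/-- The rational function `z` in `x_1, …, x_n` over `ℚℙ` is regular at `x_1 = ⋯ = x_n = 1`
and takes the value `v ∈ ℚℙ` there. -/
def HasValueAtOne {n : ℕ} (z : AmbientField n) (v : CoeffField n) : Prop :=
  ∃ N D : MvPolynomial (Fin n) (CoeffField n),
    MvPolynomial.eval (fun _ => 1) D ≠ 0 ∧
    z = algebraMap _ (AmbientField n) N / algebraMap _ (AmbientField n) D ∧
    v = MvPolynomial.eval (fun _ => 1) N / MvPolynomial.eval (fun _ => 1) D

/-- `F ∈ ℤ[y_1, …, y_n]` is the `F`-polynomial `F_{i;t}^{B;t_0}`, that is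
`x_{i;t}|_{x_1 = ⋯ = x_n = 1}` for the cluster algebra with principal coefficients at `t_0` and
initial exchange matrix `B`, where `t` is the vertex reached from `t_0` along `w`. -/
def IsFPolynomial {n : ℕ} (B : Matrix (Fin n) (Fin n) ℤ) (w : List (Fin n)) (i : Fin n)
    (F : MvPolynomial (Fin n) ℤ) : Prop :=
  HasValueAtOne ((seedAt B w).x i) (algebraMap (MvPolynomial (Fin n) ℤ) (CoeffField n) F)

/-- The coefficient of `f` at an integer vector of exponents (zero if an exponent is negative). -/
def intCoeff {m : ℕ} (f : MvPolynomial (Fin m) ℝ) (a : Fin m → ℤ) : ℝ :=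
  if ∀ j, 0 ≤ a j then f.coeff (Finsupp.equivFunOnFinite.symm fun j => (a j).toNat) else 0

/-- Log-concavity of a polynomial: it is nonzero, has non-negative real coefficients, and
`a_{…,i_j,…}^2 ≥ a_{…,i_j-1,…} a_{…,i_j+1,…}` in each variable separately. -/
def IsLogConcave {m : ℕ} (f : MvPolynomial (Fin m) ℝ) : Prop :=
  f ≠ 0 ∧ (∀ a, 0 ≤ f.coeff a) ∧
    ∀ (j : Fin m) (a : Fin m → ℤ),
      intCoeff f (a - Pi.single j 1) * intCoeff f (a + Pi.single j 1) ≤ intCoeff f a ^ 2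

end Cluster

end

noncomputable section

open Classical

namespace Cluster

variable {n : ℕ}

/-- Two chords of a convex polygon with vertices `0, 1, 2, …` cross in their interiors. -/
def Crosses (e f : ℕ × ℕ) : Prop :=
  (e.1 < f.1 ∧ f.1 < e.2 ∧ e.2 < f.2) ∨ (f.1 < e.1 ∧ e.1 < f.2 ∧ f.2 < e.2)

theorem Crosses.symm {e f : ℕ × ℕ} (h : Crosses e f) : Crosses f e := Or.symm h

/-- Labels of the edges of a triangulated `(n+3)`-gon: the `n` diagonals and the `n+3` sides. -/
abbrev EdgeLabel (n : ℕ) : Type := Fin n ⊕ Fin (n + 3)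

/-- `e` is a labeled triangulation of the polygon with vertices `0, …, n+2`: a family of `n`
distinct pairwise noncrossing diagonals, together with the sides of the polygon. -/
structure IsTriangulation {n : ℕ} (e : EdgeLabel n → ℕ × ℕ) : Prop where
  lt : ∀ j, (e j).1 < (e j).2
  le : ∀ j, (e j).2 ≤ n + 2
  inj : Function.Injective e
  noncrossing : ∀ i j, ¬ Crosses (e i) (e j)
  side : ∀ v : Fin (n + 3), e (Sum.inr v) = if (v : ℕ) = n + 2 then (0, n + 2) else ((v : ℕ), v + 1)

/-- A noncrossing set of chords on the vertices `x, …, y` has at most `2(y-x)-1` elements. -/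
theorem card_noncrossing_le (S : Finset (ℕ × ℕ)) (x y : ℕ) (hxy : x < y)
    (hS : ∀ e ∈ S, x ≤ e.1 ∧ e.1 < e.2 ∧ e.2 ≤ y)
    (hc : ∀ e ∈ S, ∀ f ∈ S, ¬ Crosses e f) : S.card + 1 ≤ 2 * (y - x) := by
  induction hd : y - x using Nat.strong_induction_on generalizing S x y with
  | _ d ih =>
  by_cases h1 : y = x + 1
  · have : S ⊆ {(x, y)} := by
      intro e he
      have := hS e he
      simp only [Finset.mem_singleton]
      ext <;> simp <;> omega
    have := Finset.card_le_card this
    simp at this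
    omega
  obtain ⟨r, hxr, hry, hr⟩ : ∃ r, x < r ∧ r < y ∧
      ∀ e ∈ S, e ≠ (x, y) → e.2 ≤ r ∨ r ≤ e.1 := by
    by_cases hT : (S.filter fun e => e.1 = x ∧ e.2 < y).Nonempty
    · obtain ⟨f, hf, hmax⟩ := Finset.exists_max_image _ (fun e => e.2) hT
      simp only [Finset.mem_filter] at hf hmax
      have hf' := hS f hf.1
      refine ⟨f.2, by omega, by omega, fun e he hne => ?_⟩
      by_contra! hcon
      have he' := hS e he
      have hcr := hc f hf.1 e he
      have hm := hmax e
      rcases Nat.eq_or_lt_of_le he'.1 with h | h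
      · rcases Nat.eq_or_lt_of_le he'.2.2 with h2 | h2
        · exact hne (Prod.ext h.symm h2)
        · have := hm ⟨he, h.symm, h2⟩
          omega
      · exact hcr (Or.inl ⟨by omega, by omega, by omega⟩)
    · refine ⟨x + 1, by omega, by omega, fun e he hne => ?_⟩
      by_contra! hcon
      have he' := hS e he
      refine hT ⟨e, ?_⟩
      simp only [Finset.mem_filter]
      refine ⟨he, by omega, ?_⟩
      rcases Nat.eq_or_lt_of_le he'.2.2 with h2 | h2
      · exact absurd (Prod.ext (by simp; omega) h2) hne
      · exact h2
  have hsub : S ⊆ insert (x, y) ((S.filter fun e => e.2 ≤ r) ∪ (S.filter fun e => r ≤ e.1)) := by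
    intro e he
    by_cases hne : e = (x, y)
    · simp [hne]
    · have := hr e he hne
      simp only [Finset.mem_insert, Finset.mem_union, Finset.mem_filter]
      tauto
  have c1 := ih (r - x) (by omega) (S.filter fun e => e.2 ≤ r) x r hxr
    (fun e he => by
      simp only [Finset.mem_filter] at he
      have := hS e he.1
      omega)
    (fun e he f hf => hc e (Finset.mem_filter.1 he).1 f (Finset.mem_filter.1 hf).1) rfl
  have c2 := ih (y - r) (by omega) (S.filter fun e => r ≤ e.1) r y hry
    (fun e he => by
      simp only [Finset.mem_filter] at he
      have := hS e he.1
      omega)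
    (fun e he f hf => hc e (Finset.mem_filter.1 he).1 f (Finset.mem_filter.1 hf).1) rfl
  have c3 := (Finset.card_le_card hsub).trans (Finset.card_insert_le _ _)
  have c4 := Finset.card_union_le (S.filter fun e => e.2 ≤ r) (S.filter fun e => r ≤ e.1)
  omega

namespace IsTriangulation

variable {n : ℕ} {e : EdgeLabel n → ℕ × ℕ}

theorem lt_of_mem (h : IsTriangulation e) {p q : ℕ} (hpq : (p, q) ∈ Set.range e) :
    p < q ∧ q ≤ n + 2 := by
  obtain ⟨j, hj⟩ := hpq
  have := h.lt j
  have := h.le j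
  simp_all

theorem not_crosses (h : IsTriangulation e) {f g : ℕ × ℕ} (hf : f ∈ Set.range e)
    (hg : g ∈ Set.range e) : ¬ Crosses f g := by
  obtain ⟨i, rfl⟩ := hf
  obtain ⟨j, rfl⟩ := hg
  exact h.noncrossing i j

theorem succ_mem (h : IsTriangulation e) {v : ℕ} (hv : v < n + 2) :
    (v, v + 1) ∈ Set.range e :=
  ⟨Sum.inr ⟨v, by omega⟩, by rw [h.side, if_neg (by simp; omega)]⟩

theorem zero_last_mem (h : IsTriangulation e) : (0, n + 2) ∈ Set.range e :=
  ⟨Sum.inr ⟨n + 2, by omega⟩, by rw [h.side, if_pos rfl]⟩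

/-- A triangulation is a maximal noncrossing family. -/
theorem mem_of_not_crosses (h : IsTriangulation e) {p q : ℕ} (hpq : p < q) (hq : q ≤ n + 2)
    (hc : ∀ f ∈ Set.range e, ¬ Crosses (p, q) f) : (p, q) ∈ Set.range e := by
  by_contra hmem
  have hnot : (p, q) ∉ Finset.univ.image e := by
    simpa using hmem
  have key := card_noncrossing_le (insert (p, q) (Finset.univ.image e)) 0 (n + 2) (by omega)
    (by
      intro f hf
      simp only [Finset.mem_insert, Finset.mem_image, Finset.mem_univ, true_and] at hf
      rcases hf with rfl | ⟨j, rfl⟩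
      · simp; omega
      · exact ⟨Nat.zero_le _, h.lt j, h.le j⟩)
    (by
      intro f hf g hg
      simp only [Finset.mem_insert, Finset.mem_image, Finset.mem_univ, true_and] at hf hg
      rcases hf with rfl | ⟨i, rfl⟩ <;> rcases hg with rfl | ⟨j, rfl⟩
      · simp only [Crosses]; omega
      · exact hc _ ⟨j, rfl⟩
      · exact fun hh => hc _ ⟨i, rfl⟩ hh.symm
      · exact h.noncrossing i j)
  rw [Finset.card_insert_of_notMem hnot, Finset.card_image_of_injective _ h.inj,
    Finset.card_univ, Fintype.card_sum, Fintype.card_fin, Fintype.card_fin] at key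
  omega

theorem exists_inner_apex (h : IsTriangulation e) {p q : ℕ} (hpq : (p, q) ∈ Set.range e)
    (hlt : p + 1 < q) :
    ∃ r, p < r ∧ r < q ∧ (p, r) ∈ Set.range e ∧ (r, q) ∈ Set.range e := by
  have hq := (h.lt_of_mem hpq).2
  obtain ⟨r, hr, hmax⟩ := Finset.exists_max_image
    ((Finset.range q).filter fun r => (p, r) ∈ Set.range e) id
    ⟨p + 1, by
      rw [Finset.mem_filter, Finset.mem_range]
      exact ⟨hlt, h.succ_mem (by omega)⟩⟩
  simp only [Finset.mem_filter, Finset.mem_range, id] at hr hmax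
  have hpr := (h.lt_of_mem hr.2).1
  refine ⟨r, hpr, hr.1, hr.2, h.mem_of_not_crosses hr.1 hq ?_⟩
  rintro ⟨s, t⟩ hst hcr
  have h1 := h.not_crosses hpq hst
  have h2 := h.not_crosses hr.2 hst
  have h3 := hmax t
  by_cases hs : s = p
  · subst hs
    have h4 : t < q → t ≤ r := fun ht => h3 ⟨ht, hst⟩
    simp only [Crosses] at *
    omega
  · simp only [Crosses] at *
    omega

theorem exists_outer_apex (h : IsTriangulation e) {p q : ℕ} (hpq : (p, q) ∈ Set.range e)
    (hne : (p, q) ≠ (0, n + 2)) :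
    (∃ r, r < p ∧ (r, p) ∈ Set.range e ∧ (r, q) ∈ Set.range e) ∨
    (∃ r, q < r ∧ (p, r) ∈ Set.range e ∧ (q, r) ∈ Set.range e) := by
  have hq := h.lt_of_mem hpq
  obtain ⟨⟨s, t⟩, hst, hmin⟩ := Finset.exists_min_image
    ((Finset.univ.image e).filter fun f => f.1 ≤ p ∧ q ≤ f.2 ∧ f ≠ (p, q)) (fun f => f.2 - f.1)
    ⟨(0, n + 2), by
      rw [Finset.mem_filter, Finset.mem_image]
      obtain ⟨j, hj⟩ := h.zero_last_mem
      exact ⟨⟨j, Finset.mem_univ _, hj⟩, Nat.zero_le _, hq.2, hne.symm⟩⟩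
  have hmem : ∀ f, f ∈ Finset.univ.image e ↔ f ∈ Set.range e := by simp
  simp only [Finset.mem_filter, hmem, ne_eq, Prod.forall, Prod.mk.injEq] at hst hmin
  obtain ⟨hst, hsp, hqt, hne'⟩ := hst
  obtain ⟨r, h1, h2, hsr, hrt⟩ := h.exists_inner_apex hst (by omega)
  have c1 := h.not_crosses hpq hsr
  have c2 := h.not_crosses hpq hrt
  have m1 := hmin s r
  have m2 := hmin r t
  simp only [Crosses] at c1 c2
  by_cases hr : r ≤ p
  · left
    have : r = p ∧ t = q := by
      by_contra hcon
      have := m2 ⟨hrt, hr, hqt, hcon⟩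
      omega
    obtain ⟨rfl, rfl⟩ := this
    exact ⟨s, h1, hsr, hst⟩
  · right
    have : s = p ∧ r = q := by
      by_contra hcon
      have := m1 ⟨hsr, hsp, by omega, hcon⟩
      omega
    obtain ⟨rfl, rfl⟩ := this
    exact ⟨t, h2, hst, hrt⟩

theorem inl_not_side (h : IsTriangulation e) (k : Fin n) :
    (e (Sum.inl k)).1 + 1 < (e (Sum.inl k)).2 ∧ e (Sum.inl k) ≠ (0, n + 2) := by
  constructor
  · have h1 := h.lt (Sum.inl k)
    have h2 := h.le (Sum.inl k)
    by_contra hcon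
    have h3 := h.side ⟨(e (Sum.inl k)).1, by omega⟩
    rw [if_neg (by simp; omega)] at h3
    have : e (Sum.inr ⟨(e (Sum.inl k)).1, by omega⟩) = e (Sum.inl k) := by
      rw [h3]; ext <;> simp; omega
    exact absurd (h.inj this) (by simp)
  · intro hk
    have h3 := h.side ⟨n + 2, by omega⟩
    rw [if_pos rfl, ← hk] at h3
    exact absurd (h.inj h3) (by simp)

/-- Every diagonal of a triangulation is a diagonal of a quadrilateral with sides in it. -/
theorem exists_quadrilateral (h : IsTriangulation e) (k : Fin n) :
    ∃ a b c d, a < b ∧ b < c ∧ c < d ∧ (a, b) ∈ Set.range e ∧ (b, c) ∈ Set.range e ∧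
      (c, d) ∈ Set.range e ∧ (a, d) ∈ Set.range e ∧
      (e (Sum.inl k) = (a, c) ∨ e (Sum.inl k) = (b, d)) := by
  obtain ⟨h1, h2⟩ := h.inl_not_side k
  have hmem : e (Sum.inl k) ∈ Set.range e := ⟨_, rfl⟩
  generalize e (Sum.inl k) = f at *
  obtain ⟨p, q⟩ := f
  obtain ⟨r, hr1, hr2, hr3, hr4⟩ := h.exists_inner_apex hmem h1
  rcases h.exists_outer_apex hmem h2 with ⟨s, hs1, hs2, hs3⟩ | ⟨s, hs1, hs2, hs3⟩
  · exact ⟨s, p, r, q, hs1, hr1, hr2, hs2, hr3, hr4, hs3, Or.inr rfl⟩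
  · exact ⟨p, r, q, s, hr1, hr2, hs1, hr3, hr4, hs3, hs2, Or.inl rfl⟩

end IsTriangulation

/-- The chords `e` and `f` are sides of a triangle with vertices `u < v < w` whose third side is in
`E`, and `f` follows `e` in the cyclic order `uv → vw → uw → uv`. -/
def Arrow (E : Set (ℕ × ℕ)) (e f : ℕ × ℕ) : Prop :=
  (e.2 = f.1 ∧ (e.1, f.2) ∈ E) ∨ (e.2 = f.2 ∧ f.1 < e.1 ∧ (f.1, e.1) ∈ E) ∨
    (e.1 = f.1 ∧ f.2 < e.2 ∧ (f.2, e.2) ∈ E)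

/-- The signed adjacency of two chords of a triangulation. -/
def adjacency (E : Set (ℕ × ℕ)) (e f : ℕ × ℕ) : ℤ :=
  (if Arrow E e f then 1 else 0) - (if Arrow E f e then 1 else 0)

theorem adjacency_swap (E : Set (ℕ × ℕ)) (e f : ℕ × ℕ) :
    adjacency E f e = - adjacency E e f := by
  simp [adjacency]

theorem adjacency_self (E : Set (ℕ × ℕ)) (e : ℕ × ℕ) : adjacency E e e = 0 := by
  simp [adjacency]

/-- `S` is a set of chords containing the four sides of the quadrilateral `abcd` and
crossing neither of its diagonals. -/
structure IsQuadrilateral (S : Set (ℕ × ℕ)) (a b c d : ℕ) : Prop where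
  ab : a < b
  bc : b < c
  cd : c < d
  mem_ab : (a, b) ∈ S
  mem_bc : (b, c) ∈ S
  mem_cd : (c, d) ∈ S
  mem_ad : (a, d) ∈ S
  lt : ∀ e ∈ S, e.1 < e.2
  not_crosses_ac : ∀ e ∈ S, ¬ Crosses e (a, c)
  not_crosses_bd : ∀ e ∈ S, ¬ Crosses e (b, d)

namespace IsQuadrilateral

variable {S : Set (ℕ × ℕ)} {a b c d : ℕ}

theorem ac_notMem (h : IsQuadrilateral S a b c d) : (a, c) ∉ S := fun hm =>
  h.not_crosses_bd _ hm (Or.inl ⟨h.ab, h.bc, h.cd⟩)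

theorem bd_notMem (h : IsQuadrilateral S a b c d) : (b, d) ∉ S := fun hm =>
  h.not_crosses_ac _ hm (Or.inr ⟨h.ab, h.bc, h.cd⟩)

theorem side_facts (h : IsQuadrilateral S a b c d) {p q : ℕ} (hx : (p, q) ∈ S) :
    p < q ∧ (a < b ∧ b < c ∧ c < d) ∧
    ¬ (p < a ∧ a < q ∧ q < c ∨ a < p ∧ p < c ∧ c < q) ∧
    ¬ (p < b ∧ b < q ∧ q < d ∨ b < p ∧ p < d ∧ d < q) :=
  ⟨h.lt _ hx, ⟨h.ab, h.bc, h.cd⟩, h.not_crosses_ac _ hx, h.not_crosses_bd _ hx⟩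

/-- The apexes of the two triangles on `ac` are `b` and `d`. -/
theorem arrow_ac (h : IsQuadrilateral S a b c d) {x : ℕ × ℕ} (hx : x ∈ S) :
    (Arrow (insert (a, c) S) x (a, c) ↔ x = (b, c) ∨ x = (a, d)) ∧
    (Arrow (insert (a, c) S) (a, c) x ↔ x = (a, b) ∨ x = (c, d)) := by
  obtain ⟨p, q⟩ := x
  have X := h.side_facts hx
  have m1 := h.mem_ab
  have m2 := h.mem_bc
  have m3 := h.mem_cd
  have m4 := h.mem_ad
  simp only [Arrow, Set.mem_insert_iff, Prod.mk.injEq]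
  refine ⟨⟨?_, ?_⟩, ⟨?_, ?_⟩⟩
  · rintro (⟨h1, h2 | h2⟩ | ⟨h1, h1', h2 | h2⟩ | ⟨h1, h1', h2 | h2⟩) <;>
      first
      | omega
      | (have Y := h.side_facts h2; omega)
  · rintro (⟨rfl, rfl⟩ | ⟨rfl, rfl⟩)
    · exact Or.inr (Or.inl ⟨rfl, by omega, Or.inr m1⟩)
    · exact Or.inr (Or.inr ⟨rfl, by omega, Or.inr m3⟩)
  · rintro (⟨h1, h2 | h2⟩ | ⟨h1, h1', h2 | h2⟩ | ⟨h1, h1', h2 | h2⟩) <;>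
      first
      | omega
      | (have Y := h.side_facts h2; omega)
  · rintro (⟨rfl, rfl⟩ | ⟨rfl, rfl⟩)
    · exact Or.inr (Or.inr ⟨rfl, by omega, Or.inr m2⟩)
    · exact Or.inl ⟨rfl, Or.inr m4⟩

theorem arrow_bd (h : IsQuadrilateral S a b c d) {x : ℕ × ℕ} (hx : x ∈ S) :
    (Arrow (insert (b, d) S) x (b, d) ↔ x = (a, b) ∨ x = (c, d)) ∧
    (Arrow (insert (b, d) S) (b, d) x ↔ x = (b, c) ∨ x = (a, d)) := by
  obtain ⟨p, q⟩ := x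
  have X := h.side_facts hx
  have m1 := h.mem_ab
  have m2 := h.mem_bc
  have m3 := h.mem_cd
  have m4 := h.mem_ad
  simp only [Arrow, Set.mem_insert_iff, Prod.mk.injEq]
  refine ⟨⟨?_, ?_⟩, ⟨?_, ?_⟩⟩
  · rintro (⟨h1, h2 | h2⟩ | ⟨h1, h1', h2 | h2⟩ | ⟨h1, h1', h2 | h2⟩) <;>
      first
      | omega
      | (have Y := h.side_facts h2; omega)
  · rintro (⟨rfl, rfl⟩ | ⟨rfl, rfl⟩)
    · exact Or.inl ⟨rfl, Or.inr m4⟩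
    · exact Or.inr (Or.inl ⟨rfl, by omega, Or.inr m2⟩)
  · rintro (⟨h1, h2 | h2⟩ | ⟨h1, h1', h2 | h2⟩ | ⟨h1, h1', h2 | h2⟩) <;>
      first
      | omega
      | (have Y := h.side_facts h2; omega)
  · rintro (⟨rfl, rfl⟩ | ⟨rfl, rfl⟩)
    · exact Or.inr (Or.inr ⟨rfl, by omega, Or.inr m3⟩)
    · exact Or.inr (Or.inl ⟨rfl, by omega, Or.inr m1⟩)

theorem arrow_insert_ac (h : IsQuadrilateral S a b c d) {x y : ℕ × ℕ} (hx : x ∈ S) (hy : y ∈ S) :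
    Arrow (insert (a, c) S) x y ↔ Arrow S x y ∨ (x = (a, b) ∧ y = (b, c)) ∨
      (x = (c, d) ∧ y = (a, d)) := by
  obtain ⟨p, q⟩ := x
  obtain ⟨r, s⟩ := y
  have X := h.side_facts hx
  have Y := h.side_facts hy
  simp only [Arrow, Set.mem_insert_iff, Prod.mk.injEq]
  constructor
  · rintro (⟨h1, h2 | h2⟩ | ⟨h1, h1', h2 | h2⟩ | ⟨h1, h1', h2 | h2⟩)
    · right; omega
    · exact Or.inl (Or.inl ⟨h1, h2⟩)
    · right; omega
    · exact Or.inl (Or.inr (Or.inl ⟨h1, h1', h2⟩))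
    · right; omega
    · exact Or.inl (Or.inr (Or.inr ⟨h1, h1', h2⟩))
  · rintro ((⟨h1, h2⟩ | ⟨h1, h1', h2⟩ | ⟨h1, h1', h2⟩) | h1 | h1)
    · exact Or.inl ⟨h1, Or.inr h2⟩
    · exact Or.inr (Or.inl ⟨h1, h1', Or.inr h2⟩)
    · exact Or.inr (Or.inr ⟨h1, h1', Or.inr h2⟩)
    · exact Or.inl ⟨by omega, Or.inl (by omega)⟩
    · exact Or.inr (Or.inl ⟨by omega, by omega, Or.inl (by omega)⟩)

theorem arrow_insert_bd (h : IsQuadrilateral S a b c d) {x y : ℕ × ℕ} (hx : x ∈ S) (hy : y ∈ S) :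
    Arrow (insert (b, d) S) x y ↔ Arrow S x y ∨ (x = (a, d) ∧ y = (a, b)) ∨
      (x = (b, c) ∧ y = (c, d)) := by
  obtain ⟨p, q⟩ := x
  obtain ⟨r, s⟩ := y
  have X := h.side_facts hx
  have Y := h.side_facts hy
  simp only [Arrow, Set.mem_insert_iff, Prod.mk.injEq]
  constructor
  · rintro (⟨h1, h2 | h2⟩ | ⟨h1, h1', h2 | h2⟩ | ⟨h1, h1', h2 | h2⟩)
    · right; omega
    · exact Or.inl (Or.inl ⟨h1, h2⟩)
    · right; omega
    · exact Or.inl (Or.inr (Or.inl ⟨h1, h1', h2⟩))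
    · right; omega
    · exact Or.inl (Or.inr (Or.inr ⟨h1, h1', h2⟩))
  · rintro ((⟨h1, h2⟩ | ⟨h1, h1', h2⟩ | ⟨h1, h1', h2⟩) | h1 | h1)
    · exact Or.inl ⟨h1, Or.inr h2⟩
    · exact Or.inr (Or.inl ⟨h1, h1', Or.inr h2⟩)
    · exact Or.inr (Or.inr ⟨h1, h1', Or.inr h2⟩)
    · exact Or.inr (Or.inr ⟨by omega, by omega, Or.inl (by omega)⟩)
    · exact Or.inl ⟨by omega, Or.inl (by omega)⟩

theorem not_arrow (h : IsQuadrilateral S a b c d) :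
    (¬ Arrow S (a, b) (b, c) ∧ ¬ Arrow S (b, c) (a, b)) ∧
    (¬ Arrow S (c, d) (a, d) ∧ ¬ Arrow S (a, d) (c, d)) ∧
    (¬ Arrow S (a, d) (a, b) ∧ ¬ Arrow S (a, b) (a, d)) ∧
    (¬ Arrow S (b, c) (c, d) ∧ ¬ Arrow S (c, d) (b, c)) := by
  have h1 := h.ab
  have h2 := h.bc
  have h3 := h.cd
  have n1 := h.ac_notMem
  have n2 := h.bd_notMem
  simp only [Arrow]
  grind

theorem adjacency_ac (h : IsQuadrilateral S a b c d) {x : ℕ × ℕ} (hx : x ∈ S) :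
    adjacency (insert (a, c) S) x (a, c) =
      (if x = (b, c) ∨ x = (a, d) then 1 else 0) - (if x = (a, b) ∨ x = (c, d) then 1 else 0) := by
  simp only [adjacency, h.arrow_ac hx]

theorem adjacency_bd (h : IsQuadrilateral S a b c d) {x : ℕ × ℕ} (hx : x ∈ S) :
    adjacency (insert (b, d) S) x (b, d) =
      (if x = (a, b) ∨ x = (c, d) then 1 else 0) - (if x = (b, c) ∨ x = (a, d) then 1 else 0) := by
  simp only [adjacency, h.arrow_bd hx]

theorem adjacency_bd_eq_neg (h : IsQuadrilateral S a b c d) {x : ℕ × ℕ} (hx : x ∈ S) :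
    adjacency (insert (b, d) S) x (b, d) = - adjacency (insert (a, c) S) x (a, c) := by
  rw [h.adjacency_ac hx, h.adjacency_bd hx]
  ring

/-- Replacing the diagonal `ac` by `bd` mutates the signed adjacencies. -/
theorem adjacency_flip (h : IsQuadrilateral S a b c d) {x y : ℕ × ℕ} (hx : x ∈ S) (hy : y ∈ S) :
    adjacency (insert (b, d) S) x y = adjacency (insert (a, c) S) x y +
      max (adjacency (insert (a, c) S) x (a, c)) 0 * adjacency (insert (a, c) S) (a, c) y +
      adjacency (insert (a, c) S) x (a, c) *
        max (- adjacency (insert (a, c) S) (a, c) y) 0 := by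
  rw [adjacency_swap _ y (a, c), h.adjacency_ac hx, h.adjacency_ac hy]
  have h1 := h.ab
  have h2 := h.bc
  have h3 := h.cd
  have na := h.not_arrow
  simp only [adjacency, h.arrow_insert_ac hx hy, h.arrow_insert_bd hx hy,
    h.arrow_insert_ac hy hx, h.arrow_insert_bd hy hx]
  have sides : ∀ z : ℕ × ℕ, z = (a, b) ∨ z = (b, c) ∨ z = (c, d) ∨ z = (a, d) ∨
      (z ≠ (a, b) ∧ z ≠ (b, c) ∧ z ≠ (c, d) ∧ z ≠ (a, d)) := by
    intro z; tauto
  have e1 : a ≠ b := by omega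
  have e2 : a ≠ c := by omega
  have e3 : a ≠ d := by omega
  have e4 : b ≠ c := by omega
  have e5 : b ≠ d := by omega
  have e6 : c ≠ d := by omega
  rcases sides x with rfl | rfl | rfl | rfl | ⟨x1, x2, x3, x4⟩ <;>
  rcases sides y with rfl | rfl | rfl | rfl | ⟨y1, y2, y3, y4⟩ <;>
  simp [*, e1.symm, e2.symm, e4.symm, e5.symm, e6.symm]

end IsQuadrilateral

/-- The signed adjacency matrix of a labeled triangulation, including the sides of the polygon. -/
def adjMatrix (e : EdgeLabel n → ℕ × ℕ) (i j : EdgeLabel n) : ℤ :=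
  adjacency (Set.range e) (e i) (e j)

/-- `e` and `e'` are triangulations that differ by exchanging the diagonals of the quadrilateral
`abcd`, both labeled by `k`. -/
structure IsFlip (e e' : EdgeLabel n → ℕ × ℕ) (k : Fin n) (a b c d : ℕ) : Prop where
  quad : IsQuadrilateral (e '' {Sum.inl k}ᶜ) a b c d
  inj : Function.Injective e
  eq_off : ∀ j ≠ Sum.inl k, e' j = e j
  diag : (e (Sum.inl k) = (a, c) ∧ e' (Sum.inl k) = (b, d)) ∨
    (e (Sum.inl k) = (b, d) ∧ e' (Sum.inl k) = (a, c))

namespace IsFlip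

variable {e e' : EdgeLabel n → ℕ × ℕ} {k : Fin n} {a b c d : ℕ}

theorem image_eq (h : IsFlip e e' k a b c d) : e' '' {Sum.inl k}ᶜ = e '' {Sum.inl k}ᶜ :=
  Set.image_congr fun j hj => h.eq_off j hj

theorem range_eq (e : EdgeLabel n → ℕ × ℕ) (k : Fin n) :
    Set.range e = insert (e (Sum.inl k)) (e '' {Sum.inl k}ᶜ) := by
  rw [← Set.image_insert_eq, ← Set.image_univ]
  congr 1
  ext j
  simp [Classical.em]

theorem range_eq' (h : IsFlip e e' k a b c d) :
    Set.range e' = insert (e' (Sum.inl k)) (e '' {Sum.inl k}ᶜ) := by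
  rw [range_eq e' k, h.image_eq]

theorem symm (h : IsFlip e e' k a b c d) : IsFlip e' e k a b c d where
  quad := h.image_eq ▸ h.quad
  inj := by
    have key : ∀ j, j ≠ Sum.inl k → e' j ≠ e' (Sum.inl k) := by
      intro j hj heq
      have hm : e' j ∈ e '' {Sum.inl k}ᶜ := ⟨j, hj, (h.eq_off j hj).symm⟩
      rw [heq] at hm
      rcases h.diag with ⟨-, h2⟩ | ⟨-, h2⟩ <;> rw [h2] at hm
      · exact h.quad.bd_notMem hm
      · exact h.quad.ac_notMem hm
    intro i j hij
    by_cases hi : i = Sum.inl k <;> by_cases hj : j = Sum.inl k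
    · rw [hi, hj]
    · subst hi; exact absurd hij.symm (key j hj)
    · subst hj; exact absurd hij (key i hi)
    · rw [h.eq_off i hi, h.eq_off j hj] at hij
      exact h.inj hij
  eq_off := fun j hj => (h.eq_off j hj).symm
  diag := by rcases h.diag with h | h <;> tauto

theorem mem_image (h : IsFlip e e' k a b c d) {j : EdgeLabel n} (hj : j ≠ Sum.inl k) :
    e' j ∈ e '' {Sum.inl k}ᶜ := ⟨j, hj, (h.eq_off j hj).symm⟩

theorem adjMatrix_mutate_of_ac (h : IsFlip e e' k a b c d) (hk : e (Sum.inl k) = (a, c))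
    (i j : EdgeLabel n) :
    adjMatrix e' i j = if i = Sum.inl k ∨ j = Sum.inl k then - adjMatrix e i j
      else adjMatrix e i j + max (adjMatrix e i (Sum.inl k)) 0 * adjMatrix e (Sum.inl k) j +
        adjMatrix e i (Sum.inl k) * max (- adjMatrix e (Sum.inl k) j) 0 := by
  have hk' : e' (Sum.inl k) = (b, d) := by
    rcases h.diag with h1 | h1
    · exact h1.2
    · exfalso
      have := hk.symm.trans h1.1
      simp only [Prod.mk.injEq] at this
      have := h.quad.ab
      omega
  have col : ∀ i, i ≠ Sum.inl k → adjMatrix e' i (Sum.inl k) = - adjMatrix e i (Sum.inl k) := by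
    intro i hi
    have hm := h.mem_image hi
    rw [adjMatrix, adjMatrix, range_eq e k, h.range_eq', h.eq_off i hi, hk, hk']
    exact h.quad.adjacency_bd_eq_neg (h.eq_off i hi ▸ hm)
  by_cases hi : i = Sum.inl k
  · subst hi
    rw [if_pos (Or.inl rfl)]
    by_cases hj : j = Sum.inl k
    · subst hj
      simp [adjMatrix, adjacency_self]
    · have := col j hj
      simp only [adjMatrix] at this ⊢
      rw [adjacency_swap _ (e' j), adjacency_swap _ (e j), this]
  · by_cases hj : j = Sum.inl k
    · subst hj
      rw [if_pos (Or.inr rfl), col i hi]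
    · rw [if_neg (by tauto)]
      simp only [adjMatrix, range_eq e k, h.range_eq', hk, hk', h.eq_off i hi, h.eq_off j hj]
      exact h.quad.adjacency_flip (h.eq_off i hi ▸ h.mem_image hi) (h.eq_off j hj ▸ h.mem_image hj)

/-- A flip of the triangulation mutates its signed adjacency matrix. -/
theorem adjMatrix_mutate (h : IsFlip e e' k a b c d) (i j : EdgeLabel n) :
    adjMatrix e' i j = if i = Sum.inl k ∨ j = Sum.inl k then - adjMatrix e i j
      else adjMatrix e i j + max (adjMatrix e i (Sum.inl k)) 0 * adjMatrix e (Sum.inl k) j +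
        adjMatrix e i (Sum.inl k) * max (- adjMatrix e (Sum.inl k) j) 0 := by
  rcases h.diag with h1 | h1
  · exact h.adjMatrix_mutate_of_ac h1.1 i j
  · have key := h.symm.adjMatrix_mutate_of_ac h1.2
    by_cases hij : i = Sum.inl k ∨ j = Sum.inl k
    · rw [if_pos hij, key i j, if_pos hij, neg_neg]
    · rw [if_neg hij, key i j, if_neg hij, key i (Sum.inl k), if_pos (Or.inr rfl),
        key (Sum.inl k) j, if_pos (Or.inl rfl)]
      generalize adjMatrix e' i (Sum.inl k) = x
      generalize adjMatrix e' (Sum.inl k) j = y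
      have hx : max (-x) 0 = max x 0 - x := by omega
      have hy : max (-y) 0 = max y 0 - y := by omega
      rw [neg_neg, hx, hy]
      ring

/-- The column of the diagonal `ac`. -/
theorem max_adjMatrix_of_ac (h : IsFlip e e' k a b c d) (hk : e (Sum.inl k) = (a, c))
    (j : EdgeLabel n) :
    max (adjMatrix e j (Sum.inl k)) 0 = (if e j = (b, c) ∨ e j = (a, d) then 1 else 0) ∧
    max (- adjMatrix e j (Sum.inl k)) 0 = (if e j = (a, b) ∨ e j = (c, d) then 1 else 0) := by
  have h1 := h.quad.ab
  have h2 := h.quad.bc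
  have h3 := h.quad.cd
  by_cases hj : j = Sum.inl k
  · subst hj
    rw [adjMatrix, adjacency_self, hk, if_neg, if_neg] <;> simp <;> omega
  · rw [adjMatrix, range_eq e k, hk, h.quad.adjacency_ac (h.eq_off j hj ▸ h.mem_image hj)]
    generalize e j = x
    obtain ⟨p, q⟩ := x
    simp only [Prod.mk.injEq]
    constructor <;> split_ifs <;> omega

/-- The column of the diagonal `bd`. -/
theorem max_adjMatrix_of_bd (h : IsFlip e e' k a b c d) (hk : e (Sum.inl k) = (b, d))
    (j : EdgeLabel n) :
    max (adjMatrix e j (Sum.inl k)) 0 = (if e j = (a, b) ∨ e j = (c, d) then 1 else 0) ∧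
    max (- adjMatrix e j (Sum.inl k)) 0 = (if e j = (b, c) ∨ e j = (a, d) then 1 else 0) := by
  have h1 := h.quad.ab
  have h2 := h.quad.bc
  have h3 := h.quad.cd
  by_cases hj : j = Sum.inl k
  · subst hj
    rw [adjMatrix, adjacency_self, hk, if_neg, if_neg] <;> simp <;> omega
  · rw [adjMatrix, range_eq e k, hk, h.quad.adjacency_bd (h.eq_off j hj ▸ h.mem_image hj)]
    generalize e j = x
    obtain ⟨p, q⟩ := x
    simp only [Prod.mk.injEq]
    constructor <;> split_ifs <;> omega

theorem mem_range (h : IsFlip e e' k a b c d) :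
    (a, b) ∈ Set.range e ∧ (b, c) ∈ Set.range e ∧ (c, d) ∈ Set.range e ∧ (a, d) ∈ Set.range e := by
  rw [range_eq e k]
  exact ⟨Or.inr h.quad.mem_ab, Or.inr h.quad.mem_bc, Or.inr h.quad.mem_cd, Or.inr h.quad.mem_ad⟩

end IsFlip

@[to_additive]
theorem prod_ite_eq_or_eq {M : Type*} [CommMonoid M] {e : EdgeLabel n → ℕ × ℕ}
    (he : Function.Injective e) (g : ℕ × ℕ → M) {x y : ℕ × ℕ} (hx : x ∈ Set.range e)
    (hy : y ∈ Set.range e) (hxy : x ≠ y) :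
    ∏ j, (if e j = x ∨ e j = y then g (e j) else 1) = g x * g y := by
  obtain ⟨i, rfl⟩ := hx
  obtain ⟨j, rfl⟩ := hy
  have hij : i ≠ j := fun h => hxy (h ▸ rfl)
  rw [← Finset.prod_pair (f := fun j => g (e j)) hij, ← Finset.prod_filter]
  congr 1
  ext l
  simp [he.eq_iff]

/-- Every diagonal of a triangulation can be flipped. -/
theorem IsTriangulation.exists_flip {e : EdgeLabel n → ℕ × ℕ} (h : IsTriangulation e) (k : Fin n) :
    ∃ e' a b c d, IsTriangulation e' ∧ IsFlip e e' k a b c d := by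
  obtain ⟨a, b, c, d, h1, h2, h3, mab, mbc, mcd, mad, hdiag⟩ := h.exists_quadrilateral k
  have hd := (h.lt_of_mem mad).2
  have hmem : ∀ {x}, x ∈ Set.range e → x ≠ e (Sum.inl k) → x ∈ e '' {Sum.inl k}ᶜ := by
    rintro _ ⟨j, rfl⟩ hne
    exact ⟨j, fun hj => hne (by rw [hj]), rfl⟩
  have hS : ∀ x ∈ e '' {Sum.inl k}ᶜ, x ∈ Set.range e ∧ x ≠ e (Sum.inl k) := by
    rintro _ ⟨j, hj, rfl⟩
    exact ⟨⟨j, rfl⟩, fun hne => hj (h.inj hne)⟩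
  have hcr : ∀ x ∈ e '' {Sum.inl k}ᶜ, ¬ Crosses x (a, c) ∧ ¬ Crosses x (b, d) := by
    intro x hx
    obtain ⟨hx, hne⟩ := hS x hx
    have c1 := h.not_crosses hx mab
    have c2 := h.not_crosses hx mbc
    have c3 := h.not_crosses hx mcd
    have c4 := h.not_crosses hx mad
    have c5 := h.not_crosses hx ⟨Sum.inl k, rfl⟩
    obtain ⟨p, q⟩ := x
    rcases hdiag with hk | hk <;> rw [hk] at c5 hne <;>
      simp only [Crosses, ne_eq, Prod.mk.injEq] at * <;> omega
  have hq : IsQuadrilateral (e '' {Sum.inl k}ᶜ) a b c d := by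
    refine ⟨h1, h2, h3, hmem mab ?_, hmem mbc ?_, hmem mcd ?_, hmem mad ?_, ?_,
      fun x hx => (hcr x hx).1, fun x hx => (hcr x hx).2⟩
    iterate 4
      · rcases hdiag with hk | hk <;> rw [hk] <;> simp only [ne_eq, Prod.mk.injEq] <;> omega
    · rintro _ ⟨j, -, rfl⟩
      exact h.lt j
  obtain ⟨f, hf⟩ : ∃ f, (e (Sum.inl k) = (a, c) ∧ f = (b, d)) ∨
      (e (Sum.inl k) = (b, d) ∧ f = (a, c)) := by
    rcases hdiag with hk | hk
    · exact ⟨_, Or.inl ⟨hk, rfl⟩⟩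
    · exact ⟨_, Or.inr ⟨hk, rfl⟩⟩
  have hflip : IsFlip e (Function.update e (Sum.inl k) f) k a b c d :=
    ⟨hq, h.inj, fun j hj => Function.update_of_ne hj _ _, by simpa using hf⟩
  have hf' : f.1 < f.2 ∧ f.2 ≤ n + 2 ∧ ∀ x ∈ e '' {Sum.inl k}ᶜ, ¬ Crosses x f := by
    rcases hf with ⟨-, rfl⟩ | ⟨-, rfl⟩
    · exact ⟨h2.trans h3, hd, fun x hx => (hcr x hx).2⟩
    · exact ⟨h1.trans h2, by simp; omega, fun x hx => (hcr x hx).1⟩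
  refine ⟨_, a, b, c, d, ⟨?_, ?_, hflip.symm.inj, ?_, ?_⟩, hflip⟩
  · intro j
    by_cases hj : j = Sum.inl k
    · subst hj; simpa using hf'.1
    · simpa [hj] using h.lt j
  · intro j
    by_cases hj : j = Sum.inl k
    · subst hj; simpa using hf'.2.1
    · simpa [hj] using h.le j
  · intro i j
    by_cases hi : i = Sum.inl k <;> by_cases hj : j = Sum.inl k
    · subst hi; subst hj
      simp only [Crosses]; omega
    · subst hi
      simp only [Function.update_self, Function.update_of_ne hj]
      exact fun hh => hf'.2.2 _ ⟨j, hj, rfl⟩ hh.symm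
    · subst hj
      simp only [Function.update_self, Function.update_of_ne hi]
      exact hf'.2.2 _ ⟨i, hi, rfl⟩
    · simp only [Function.update_of_ne hj, Function.update_of_ne hi]
      exact h.noncrossing i j
  · intro v
    rw [Function.update_of_ne (by simp)]
    exact h.side v

/-- `B` is the signed adjacency matrix of some triangulation of the `(n+3)`-gon. -/
def IsPolygonMatrix (B : Matrix (Fin n) (Fin n) ℤ) : Prop :=
  ∃ e : EdgeLabel n → ℕ × ℕ, IsTriangulation e ∧
    ∀ i j, B i j = adjMatrix e (Sum.inl i) (Sum.inl j)

theorem mutateMatrix_eq_of_flip {e e' : EdgeLabel n → ℕ × ℕ} {k : Fin n} {a b c d : ℕ}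
    (hf : IsFlip e e' k a b c d) {B : Matrix (Fin n) (Fin n) ℤ}
    (hB : ∀ i j, B i j = adjMatrix e (Sum.inl i) (Sum.inl j)) (i j : Fin n) :
    mutateMatrix k B i j = adjMatrix e' (Sum.inl i) (Sum.inl j) := by
  rw [hf.adjMatrix_mutate]
  simp only [mutateMatrix, Matrix.of_apply, hB, Sum.inl.injEq]

theorem IsPolygonMatrix.mutate {B : Matrix (Fin n) (Fin n) ℤ} (h : IsPolygonMatrix B) (k : Fin n) :
    IsPolygonMatrix (mutateMatrix k B) := by
  obtain ⟨e, he, hB⟩ := h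
  obtain ⟨e', a, b, c, d, he', hf⟩ := he.exists_flip k
  exact ⟨e', he', mutateMatrix_eq_of_flip hf hB⟩

theorem mutateMatrix_mutateMatrix (k : Fin n) (B : Matrix (Fin n) (Fin n) ℤ) :
    mutateMatrix k (mutateMatrix k B) = B := by
  ext i j
  by_cases hij : i = k ∨ j = k
  · simp [mutateMatrix, hij]
  · simp only [mutateMatrix, Matrix.of_apply, hij, if_false, true_or, or_true, if_true]
    generalize B i k = x
    generalize B k j = y
    have hx : max (-x) 0 = max x 0 - x := by omega
    have hy : max (-y) 0 = max y 0 - y := by omega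
    rw [neg_neg, hx, hy]
    ring

theorem seedAt_append (B : Matrix (Fin n) (Fin n) ℤ) (w : List (Fin n)) (k : Fin n) :
    seedAt B (w ++ [k]) = (seedAt B w).mutate k := by
  simp [seedAt]

theorem isPolygonMatrix_of_seedAt {B : Matrix (Fin n) (Fin n) ℤ} (w : List (Fin n))
    (h : IsPolygonMatrix (seedAt B w).B) : IsPolygonMatrix B := by
  induction w using List.reverseRecOn with
  | nil => exact h
  | append_singleton w k ih =>
    rw [seedAt_append] at h
    have := h.mutate k
    rw [Seed.mutate, mutateMatrix_mutateMatrix] at this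
    exact ih this

theorem IsSkewSymmetrizable.mutate {B : Matrix (Fin n) (Fin n) ℤ} (h : IsSkewSymmetrizable B)
    (k : Fin n) : IsSkewSymmetrizable (mutateMatrix k B) := by
  obtain ⟨d, hd, h⟩ := h
  refine ⟨d, hd, fun i j => ?_⟩
  by_cases hij : i = k ∨ j = k
  · simp only [mutateMatrix, Matrix.of_apply, hij, hij.symm, if_true]
    linarith [h i j]
  · have hji : ¬ (j = k ∨ i = k) := fun h => hij h.symm
    simp only [mutateMatrix, Matrix.of_apply, hij, hji, if_false]
    have e1 : d i * max (B i k) 0 = d k * max (- B k i) 0 := by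
      have := h i k
      rw [mul_max_of_nonneg _ _ (hd i).le, mul_max_of_nonneg _ _ (hd k).le]
      congr 1 <;> linarith
    have e3 : d k * max (- B k j) 0 = d j * max (B j k) 0 := by
      have := h j k
      rw [mul_max_of_nonneg _ _ (hd j).le, mul_max_of_nonneg _ _ (hd k).le]
      congr 1 <;> linarith
    have e4 := h i j
    have e5 := h i k
    have e6 := h k j
    calc d i * (B i j + max (B i k) 0 * B k j + B i k * max (- B k j) 0)
        = d i * B i j + (d i * max (B i k) 0) * B k j + (d i * B i k) * max (- B k j) 0 := by ring
      _ = - (d j * B j i) + (d k * B k j) * max (- B k i) 0 - (d k * max (- B k j) 0) * B k i := by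
          rw [e4, e1, e5]; ring
      _ = - (d j * (B j i + max (B j k) 0 * B k i + B j k * max (- B k i) 0)) := by
          rw [e6, e3]; ring

theorem isSkewSymmetrizable_seedAt {B : Matrix (Fin n) (Fin n) ℤ} (h : IsSkewSymmetrizable B)
    (w : List (Fin n)) : IsSkewSymmetrizable (seedAt B w).B := by
  induction w using List.reverseRecOn with
  | nil => exact h
  | append_singleton w k ih =>
    rw [seedAt_append]
    exact ih.mutate k

/-- The left endpoints of the diagonals of the snake triangulation: the `i`-th step moves the left
endpoint if `s i` and the right endpoint otherwise. -/
def snakeLeft (s : ℕ → Prop) : ℕ → ℕ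
  | 0 => 1
  | i + 1 => snakeLeft s i + if s i then 1 else 0

/-- The sides of the polygon with vertices `0, …, n+2`. -/
def polygonSide (n : ℕ) (v : Fin (n + 3)) : ℕ × ℕ :=
  if (v : ℕ) = n + 2 then (0, n + 2) else ((v : ℕ), v + 1)

/-- The snake triangulation, with the diagonals labeled through `σ`. -/
def snake (s : ℕ → Prop) (σ : Equiv.Perm (Fin n)) : EdgeLabel n → ℕ × ℕ
  | Sum.inl i => (snakeLeft s (σ i), snakeLeft s (σ i) + (n + 1 - σ i))
  | Sum.inr v => polygonSide n v

theorem snakeLeft_add (s : ℕ → Prop) (i j : ℕ) :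
    snakeLeft s i ≤ snakeLeft s (i + j) ∧ snakeLeft s (i + j) ≤ snakeLeft s i + j := by
  induction j with
  | zero => simp
  | succ j ih =>
    rw [← add_assoc, snakeLeft]
    split_ifs <;> omega

theorem snakeLeft_le (s : ℕ → Prop) {i j : ℕ} (h : i ≤ j) :
    snakeLeft s i ≤ snakeLeft s j ∧ snakeLeft s j ≤ snakeLeft s i + (j - i) := by
  obtain ⟨l, rfl⟩ := Nat.exists_eq_add_of_le h
  have := snakeLeft_add s i l
  omega

theorem polygonSide_cases (v : Fin (n + 3)) :
    (polygonSide n v = (0, n + 2) ∧ (v : ℕ) = n + 2) ∨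
      (polygonSide n v = ((v : ℕ), (v : ℕ) + 1) ∧ (v : ℕ) < n + 2) := by
  have := v.2
  unfold polygonSide
  split_ifs with h
  · exact Or.inl ⟨rfl, h⟩
  · exact Or.inr ⟨rfl, by omega⟩

theorem snake_isTriangulation (s : ℕ → Prop) (σ : Equiv.Perm (Fin n)) :
    IsTriangulation (snake s σ) := by
  have key : ∀ i : Fin n, 1 ≤ snakeLeft s i ∧ snakeLeft s i ≤ 1 + i := by
    intro i
    have := snakeLeft_le s (Nat.zero_le i)
    simp only [snakeLeft] at this
    omega
  refine ⟨?_, ?_, ?_, ?_, fun v => rfl⟩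
  · rintro (i | v)
    · have := (σ i).2
      simp only [snake]; omega
    · rcases polygonSide_cases v with h | h <;> simp only [snake, h.1] <;> omega
  · rintro (i | v)
    · have := (σ i).2
      have := key (σ i)
      simp only [snake]; omega
    · rcases polygonSide_cases v with h | h <;> simp only [snake, h.1] <;> omega
  · rintro (i | v) (j | w) hij
    · simp only [snake, Prod.mk.injEq] at hij
      have := (σ i).2
      have := (σ j).2
      have : σ i = σ j := Fin.ext (by omega)
      rw [σ.injective this]
    · exfalso
      have := (σ i).2
      have := key (σ i)
      rcases polygonSide_cases w with h | h <;>
        simp only [snake, h.1, Prod.mk.injEq] at hij <;> omega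
    · exfalso
      have := (σ j).2
      have := key (σ j)
      rcases polygonSide_cases v with h | h <;>
        simp only [snake, h.1, Prod.mk.injEq] at hij <;> omega
    · congr 1
      rcases polygonSide_cases v with h | h <;> rcases polygonSide_cases w with h' | h' <;>
        simp only [snake, h.1, h'.1, Prod.mk.injEq] at hij <;> exact Fin.ext (by omega)
  · rintro (i | v) (j | w)
    · have := (σ i).2
      have := (σ j).2
      simp only [snake, Crosses]
      rcases le_total (σ i : ℕ) (σ j) with h | h <;> have := snakeLeft_le s h <;> omega
    · have := (σ i).2
      have := key (σ i)
      rcases polygonSide_cases w with h | h <;> simp only [snake, h.1, Crosses] <;> omega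
    · have := (σ j).2
      have := key (σ j)
      rcases polygonSide_cases v with h | h <;> simp only [snake, h.1, Crosses] <;> omega
    · rcases polygonSide_cases v with h | h <;> rcases polygonSide_cases w with h' | h' <;>
        simp only [snake, h.1, h'.1, Crosses] <;> omega

theorem mem_range_snake {s : ℕ → Prop} {σ : Equiv.Perm (Fin n)} {p q : ℕ}
    (h : (p, q) ∈ Set.range (snake s σ)) :
    q = p + 1 ∨ (p = 0 ∧ q = n + 2) ∨
      ∃ i : Fin n, p = snakeLeft s i ∧ q = snakeLeft s i + (n + 1 - i) := by
  obtain ⟨i | v, hi⟩ := h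
  · simp only [snake, Prod.mk.injEq] at hi
    exact Or.inr (Or.inr ⟨σ i, hi.1.symm, hi.2.symm⟩)
  · rcases polygonSide_cases v with h | h <;> simp only [snake, h.1, Prod.mk.injEq] at hi <;> omega

theorem adjMatrix_snake_succ (s : ℕ → Prop) (σ : Equiv.Perm (Fin n)) (i j : Fin n)
    (hij : (σ i : ℕ) + 1 = σ j) :
    adjMatrix (snake s σ) (Sum.inl i) (Sum.inl j) = if s (σ i) then -1 else 1 := by
  have ht := snake_isTriangulation s σ
  have h1 := (σ i).2
  have h2 := (σ j).2
  have hle := snakeLeft_le s (Nat.zero_le (σ i))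
  simp only [snakeLeft] at hle
  have hj : snakeLeft s (σ j) = snakeLeft s (σ i) + if s (σ i) then 1 else 0 := by
    rw [← hij, snakeLeft]
  simp only [adjMatrix, adjacency, snake, hj]
  split_ifs with hs h3 h4 h4 h3 h4 h4
  all_goals first
    | rfl
    | (exfalso; simp only [Arrow] at *; omega)
    | skip
  · exact absurd (Or.inr (Or.inl 
      ⟨by simp only; omega, by simp only; omega, ht.succ_mem (by omega)⟩)) h4
  · refine absurd (Or.inr (Or.inr ⟨by simp only; omega, by simp only; omega, ?_⟩)) h3
    convert ht.succ_mem (v := snakeLeft s (σ i) + (n + 1 - σ j)) (by omega) using 2 <;>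
      dsimp only <;> omega

theorem adjMatrix_snake_far (s : ℕ → Prop) (σ : Equiv.Perm (Fin n)) (i j : Fin n)
    (hij : (σ i : ℕ) + 1 < σ j) :
    adjMatrix (snake s σ) (Sum.inl i) (Sum.inl j) = 0 := by
  have h1 := (σ i).2
  have h2 := (σ j).2
  have h3 := snakeLeft_le s (show (σ i : ℕ) ≤ σ j by omega)
  have hle := snakeLeft_le s (Nat.zero_le (σ i))
  simp only [snakeLeft] at hle
  have far : ∀ {p q}, (p, q) ∈ Set.range (snake s σ) →
      (p = snakeLeft s (σ i) ∧ q = snakeLeft s (σ j)) ∨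
      (p = snakeLeft s (σ j) + (n + 1 - σ j) ∧ q = snakeLeft s (σ i) + (n + 1 - σ i)) →
      q ≤ p + 1 := by
    intro p q hm hpq
    rcases mem_range_snake hm with h | h | ⟨l, h, h'⟩
    · omega
    · omega
    · have := l.2
      rcases le_total (l : ℕ) (σ j) with hl | hl <;> have := snakeLeft_le s hl <;> omega
  have e1 : ¬ Arrow (Set.range (snake s σ)) (snake s σ (Sum.inl i)) (snake s σ (Sum.inl j)) := by
    simp only [Arrow, snake]
    rintro (⟨h, -⟩ | ⟨h, h', -⟩ | ⟨h, h', hm⟩)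
    · omega
    · omega
    · have := far hm (Or.inr ⟨by omega, by omega⟩)
      omega
  have e2 : ¬ Arrow (Set.range (snake s σ)) (snake s σ (Sum.inl j)) (snake s σ (Sum.inl i)) := by
    simp only [Arrow, snake]
    rintro (⟨h, -⟩ | ⟨h, h', hm⟩ | ⟨h, h', -⟩)
    · omega
    · have := far hm (Or.inl ⟨by omega, by omega⟩)
      omega
    · omega
  simp [adjMatrix, adjacency, e1, e2]

/-- Every orientation of the path is the signed adjacency matrix of a snake triangulation. -/
theorem isPolygonMatrix_of_cartanCounterpart {B : Matrix (Fin n) (Fin n) ℤ}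
    (hB : IsSkewSymmetrizable B) (σ : Equiv.Perm (Fin n))
    (hA : (cartanCounterpart B).submatrix σ σ = CartanMatrix.A n) : IsPolygonMatrix B := by
  obtain ⟨d, hd, hskew⟩ := hB
  have habs : ∀ i j, i ≠ j → |B i j| =
      if (σ.symm i : ℕ) + 1 = σ.symm j ∨ (σ.symm j : ℕ) + 1 = σ.symm i then 1 else 0 := by
    intro i j hij
    have := congrFun (congrFun hA (σ.symm i)) (σ.symm j)
    simp only [Matrix.submatrix_apply, Equiv.apply_symm_apply, cartanCounterpart, Matrix.of_apply,
      hij, CartanMatrix.A, EmbeddingLike.apply_eq_iff_eq, if_false] at this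
    split_ifs at this ⊢ <;> omega
  have hdiag : ∀ i, B i i = 0 := by
    intro i
    have := hskew i i
    have h2 : d i * B i i = 0 := by linarith
    exact (mul_eq_zero.1 h2).resolve_left (hd i).ne'
  have hanti : ∀ i j, B j i = - B i j := by
    intro i j
    by_cases hij : i = j
    · subst hij; simp [hdiag]
    have h1 := habs i j hij
    have h2 := habs j i (Ne.symm hij)
    simp only [or_comm (a := (σ.symm j : ℕ) + 1 = σ.symm i), ← h1] at h2
    rcases abs_eq_abs.1 h2 with h3 | h3
    · have h4 := hskew i j
      rw [h3] at h4 ⊢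
      have h5 : (d i + d j) * B i j = 0 := by linarith
      have := (mul_eq_zero.1 h5).resolve_left (by have := hd i; have := hd j; omega)
      omega
    · exact h3
  refine ⟨snake (fun l => ∃ i j : Fin n, (σ.symm i : ℕ) = l ∧ (σ.symm j : ℕ) = l + 1 ∧ B i j = -1)
    σ.symm, snake_isTriangulation _ _, ?_⟩
  have main : ∀ i j, (σ.symm i : ℕ) < σ.symm j → B i j = adjMatrix
      (snake (fun l => ∃ i j : Fin n, (σ.symm i : ℕ) = l ∧ (σ.symm j : ℕ) = l + 1 ∧ B i j = -1)
        σ.symm) (Sum.inl i) (Sum.inl j) := by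
    intro i j hij
    have hne : i ≠ j := by rintro rfl; exact lt_irrefl _ hij
    have h1 := habs i j hne
    rcases Nat.eq_or_lt_of_le (Nat.succ_le_of_lt hij) with h | h
    · rw [adjMatrix_snake_succ _ _ _ _ h]
      rw [if_pos (Or.inl h)] at h1
      have hiff : (∃ i' j' : Fin n, (σ.symm i' : ℕ) = σ.symm i ∧
          (σ.symm j' : ℕ) = σ.symm i + 1 ∧ B i' j' = -1) ↔ B i j = -1 := by
        constructor
        · rintro ⟨i', j', h2, h3, h4⟩
          have : i' = i := σ.symm.injective (Fin.ext h2)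
          have : j' = j := σ.symm.injective (Fin.ext (h3.trans h))
          subst_vars
          exact h4
        · exact fun h2 => ⟨i, j, rfl, h.symm, h2⟩
      simp only [hiff]
      rcases (abs_eq zero_le_one).1 h1 with h2 | h2 <;> simp [h2]
    · rw [adjMatrix_snake_far _ _ _ _ h]
      rw [if_neg (by omega)] at h1
      exact abs_eq_zero.1 h1
  intro i j
  rcases lt_trichotomy (σ.symm i : ℕ) (σ.symm j) with h | h | h
  · exact main i j h
  · have : i = j := σ.symm.injective (Fin.ext h)
    subst this
    rw [hdiag, adjMatrix, adjacency_self]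
  · rw [hanti j i, main j i h, adjMatrix, adjMatrix, adjacency_swap _ _ (snake _ _ (Sum.inl j)),
      neg_neg]

theorem IsTypeA.isPolygonMatrix {B : Matrix (Fin n) (Fin n) ℤ} (hA : IsTypeA B)
    (hB : IsSkewSymmetrizable B) : IsPolygonMatrix B := by
  obtain ⟨w, σ, h⟩ := hA
  exact isPolygonMatrix_of_seedAt w
    (isPolygonMatrix_of_cartanCounterpart (isSkewSymmetrizable_seedAt hB w) σ h)

/-- The Laurent monomial with exponent vector `v` as an element of `ℚℙ`. -/
def laurentMonomial (v : Fin n → ℤ) : CoeffField n := Trop.toCoeff (Multiplicative.ofAdd v)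

theorem algebraMap_X_ne_zero (i : Fin n) :
    algebraMap (MvPolynomial (Fin n) ℤ) (CoeffField n) (MvPolynomial.X i) ≠ 0 := by
  rw [Ne, IsFractionRing.to_map_eq_zero_iff]
  exact MvPolynomial.X_ne_zero i

theorem laurentMonomial_ne_zero (v : Fin n → ℤ) : laurentMonomial v ≠ 0 := by
  rw [laurentMonomial, Trop.toCoeff]
  exact Finset.prod_ne_zero_iff.2 fun i _ => zpow_ne_zero _ (algebraMap_X_ne_zero i)

theorem laurentMonomial_add (v w : Fin n → ℤ) :
    laurentMonomial (v + w) = laurentMonomial v * laurentMonomial w := by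
  simp only [laurentMonomial, Trop.toCoeff, toAdd_ofAdd, Pi.add_apply]
  rw [← Finset.prod_mul_distrib]
  exact Finset.prod_congr rfl fun i _ => zpow_add₀ (algebraMap_X_ne_zero i) _ _

theorem laurentMonomial_eq_monomial (v : Fin n → ℤ) (hv : ∀ i, 0 ≤ v i) :
    laurentMonomial v = algebraMap (MvPolynomial (Fin n) ℤ) (CoeffField n)
      (∏ i, MvPolynomial.X i ^ (v i).toNat) := by
  simp only [laurentMonomial, Trop.toCoeff, toAdd_ofAdd, map_prod, map_pow]
  refine Finset.prod_congr rfl fun i _ => ?_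
  conv_lhs => rw [← Int.toNat_of_nonneg (hv i)]
  rw [zpow_natCast]

/-- The exponents that normalize the lambda length of the chord `x`: half the number of crossings
with the elementary lamination of each diagonal of `e`, up to gauge. -/
def laminationExp (e : EdgeLabel n → ℕ × ℕ) (x : ℕ × ℕ) (i : Fin n) : ℤ :=
  if (e (Sum.inl i)).1 < x.1 ∧ x.2 ≤ (e (Sum.inl i)).2 then 1 else 0

/-- The tropical Ptolemy relation. -/
theorem laminationExp_ptolemy (e : EdgeLabel n → ℕ × ℕ) {a b c d : ℕ} (hab : a < b) (hbc : b < c)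
    (hcd : c < d) (i : Fin n) :
    laminationExp e (a, c) i + laminationExp e (b, d) i =
      min (laminationExp e (b, c) i + laminationExp e (a, d) i)
        (laminationExp e (a, b) i + laminationExp e (c, d) i) := by
  simp only [laminationExp]
  split_ifs <;> omega

/-- The determinant of the vectors attached to the endpoints of a chord. -/
def chordDet {K : Type*} [Field K] (V : ℕ → K × K) (x : ℕ × ℕ) : K :=
  (V x.1).1 * (V x.2).2 - (V x.1).2 * (V x.2).1

/-- Vectors in the plane with prescribed determinants along the edges of a triangulation that lie
under a given edge. -/
theorem IsTriangulation.exists_vectors_under {K : Type*} [Field K] {e : EdgeLabel n → ℕ × ℕ}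
    (h : IsTriangulation e) (g : ℕ × ℕ → K) (hg : ∀ x, g x ≠ 0) (l : ℕ) :
    ∀ p q : ℕ, q - p ≤ l → (p, q) ∈ Set.range e → ∀ v w : K × K,
      v.1 * w.2 - v.2 * w.1 = g (p, q) →
      ∃ V : ℕ → K × K, V p = v ∧ V q = w ∧
        ∀ s t, (s, t) ∈ Set.range e → p ≤ s → t ≤ q → chordDet V (s, t) = g (s, t) := by
  induction l with
  | zero =>
    intro p q hl hpq
    have := h.lt_of_mem hpq
    omega
  | succ l ih =>
    intro p q hl hpq v w hvw
    have hlt := h.lt_of_mem hpq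
    by_cases hq : q = p + 1
    · subst hq
      refine ⟨fun x => if x = p then v else w, by simp, by simp, fun s t hst hs ht => ?_⟩
      have := h.lt_of_mem hst
      obtain rfl : s = p := by omega
      obtain rfl : t = s + 1 := by omega
      simpa [chordDet] using hvw
    · obtain ⟨r, hpr, hrq, mpr, mrq⟩ := h.exists_inner_apex hpq (by omega)
      have hne := hg (p, q)
      set u : K × K := ((g (r, q) * v.1 + g (p, r) * w.1) / g (p, q),
        (g (r, q) * v.2 + g (p, r) * w.2) / g (p, q)) with hu
      have h1 : v.1 * u.2 - v.2 * u.1 = g (p, r) := by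
        simp only [hu]
        field_simp
        rw [← hvw]; ring
      have h2 : u.1 * w.2 - u.2 * w.1 = g (r, q) := by
        simp only [hu]
        field_simp
        rw [← hvw]; ring
      obtain ⟨V, hV1, hV2, hV⟩ := ih p r (by omega) mpr v u h1
      obtain ⟨W, hW1, hW2, hW⟩ := ih r q (by omega) mrq u w h2
      refine ⟨fun x => if x ≤ r then V x else W x, by simp [hpr.le, hV1],
        by simp [hrq, hW2], fun s t hst hs ht => ?_⟩
      have hst' := h.lt_of_mem hst
      by_cases htr : t ≤ r
      · have hsr : s ≤ r := by omega
        have := hV s t hst hs htr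
        simpa [chordDet, htr, hsr] using this
      · by_cases hrs : r ≤ s
        · have key : (if s ≤ r then V s else W s) = W s := by
            split_ifs with hh
            · obtain rfl : s = r := by omega
              rw [hV2, hW1]
            · rfl
          have := hW s t hst hrs ht
          simpa [chordDet, htr, key] using this
        · have c1 := h.not_crosses hst mpr
          have c2 := h.not_crosses hst mrq
          simp only [Crosses] at c1 c2
          obtain rfl : s = p := by omega
          obtain rfl : t = q := by omega
          simpa [chordDet, htr, hpr.le, hV1, hW2] using hvw

theorem IsTriangulation.exists_vectors {K : Type*} [Field K] {e : EdgeLabel n → ℕ × ℕ}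
    (h : IsTriangulation e) (g : ℕ × ℕ → K) (hg : ∀ x, g x ≠ 0) :
    ∃ V : ℕ → K × K, ∀ x ∈ Set.range e, chordDet V x = g x := by
  obtain ⟨V, -, -, hV⟩ := h.exists_vectors_under g hg (n + 2) 0 (n + 2) (by omega)
    h.zero_last_mem (1, 0) (0, g (0, n + 2)) (by simp)
  refine ⟨V, fun x hx => hV x.1 x.2 hx (Nat.zero_le _) ?_⟩
  obtain ⟨j, rfl⟩ := hx
  exact h.le j

/-- `F` is a system of lambda lengths of the chords of the polygon, normalized so that it is `1` on
the triangulation `e`. -/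
structure IsNormalizedLength (e : EdgeLabel n → ℕ × ℕ) (F : ℕ × ℕ → CoeffField n) : Prop where
  eq_one : ∀ x ∈ Set.range e, F x = 1
  exchange : ∀ a b c d, a < b → b < c → c < d → F (a, c) * F (b, d) =
    laurentMonomial (fun i => max (laminationExp e (b, c) i + laminationExp e (a, d) i -
      (laminationExp e (a, b) i + laminationExp e (c, d) i)) 0) * (F (b, c) * F (a, d)) +
    laurentMonomial (fun i => max (laminationExp e (a, b) i + laminationExp e (c, d) i -
      (laminationExp e (b, c) i + laminationExp e (a, d) i)) 0) * (F (a, b) * F (c, d))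

theorem IsTriangulation.exists_normalizedLength {e : EdgeLabel n → ℕ × ℕ}
    (h : IsTriangulation e) : ∃ F, IsNormalizedLength e F := by
  obtain ⟨V, hV⟩ := h.exists_vectors (fun x => laurentMonomial (laminationExp e x))
    fun x => laurentMonomial_ne_zero _
  refine ⟨fun x => chordDet V x / laurentMonomial (laminationExp e x), fun x hx => ?_,
    fun a b c d hab hbc hcd => ?_⟩
  · simp only [hV x hx]
    exact div_self (laurentMonomial_ne_zero _)
  · have hpl : chordDet V (a, c) * chordDet V (b, d) =
        chordDet V (b, c) * chordDet V (a, d) + chordDet V (a, b) * chordDet V (c, d) := by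
      simp only [chordDet]; ring
    have key := laminationExp_ptolemy e hab hbc hcd
    have e1 : laurentMonomial (laminationExp e (b, c)) * laurentMonomial (laminationExp e (a, d)) =
        laurentMonomial (fun i => max (laminationExp e (b, c) i + laminationExp e (a, d) i -
          (laminationExp e (a, b) i + laminationExp e (c, d) i)) 0) *
        (laurentMonomial (laminationExp e (a, c)) * laurentMonomial (laminationExp e (b, d))) := by
      simp only [← laurentMonomial_add]
      congr 1
      funext i
      have := key i
      simp only [Pi.add_apply]
      omega
    have e2 : laurentMonomial (laminationExp e (a, b)) * laurentMonomial (laminationExp e (c, d)) =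
        laurentMonomial (fun i => max (laminationExp e (a, b) i + laminationExp e (c, d) i -
          (laminationExp e (b, c) i + laminationExp e (a, d) i)) 0) *
        (laurentMonomial (laminationExp e (a, c)) * laurentMonomial (laminationExp e (b, d))) := by
      simp only [← laurentMonomial_add]
      congr 1
      funext i
      have := key i
      simp only [Pi.add_apply]
      omega
    have hne := fun x => laurentMonomial_ne_zero (laminationExp e x)
    rw [div_mul_div_comm, div_mul_div_comm, div_mul_div_comm, hpl, e1, e2]
    have n1 := laurentMonomial_ne_zero (fun i => max (laminationExp e (b, c) i +
      laminationExp e (a, d) i - (laminationExp e (a, b) i + laminationExp e (c, d) i)) 0)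
    have n2 := laurentMonomial_ne_zero (fun i => max (laminationExp e (a, b) i +
      laminationExp e (c, d) i - (laminationExp e (b, c) i + laminationExp e (a, d) i)) 0)
    have n3 := hne (a, c)
    have n4 := hne (b, d)
    field_simp

/-- `z` is a nonzero polynomial with nonnegative coefficients, at most linear in each variable, in
the variables whose diagonals cross the chord `x`. -/
def IsMultilinear (e : EdgeLabel n → ℕ × ℕ) (x : ℕ × ℕ) (z : CoeffField n) : Prop :=
  ∃ P : MvPolynomial (Fin n) ℤ, z = algebraMap _ _ P ∧ (∀ m, 0 ≤ P.coeff m) ∧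
    0 < MvPolynomial.eval (fun _ => 1) P ∧
    ∀ i, P.degreeOf i ≤ if Crosses (e (Sum.inl i)) x then 1 else 0

theorem degreeOf_prod_X_pow_le (m : Fin n → ℕ) (i : Fin n) :
    (∏ j, (MvPolynomial.X j : MvPolynomial (Fin n) ℤ) ^ m j).degreeOf i ≤ m i := by
  refine (MvPolynomial.degreeOf_prod_le _ _ _).trans ?_
  rw [Finset.sum_eq_single i]
  · refine (MvPolynomial.degreeOf_pow_le _ _ _).trans ?_
    simp
  · intro j _ hj
    refine Nat.le_zero.1 ((MvPolynomial.degreeOf_pow_le _ _ _).trans ?_)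
    simp [MvPolynomial.degreeOf_X, hj.symm]
  · simp

theorem coeff_prod_X_pow_mul_nonneg (m : Fin n → ℕ) {P : MvPolynomial (Fin n) ℤ}
    (hP : ∀ s, 0 ≤ P.coeff s) (s : Fin n →₀ ℕ) :
    0 ≤ ((∏ j, MvPolynomial.X j ^ m j) * P).coeff s := by
  have key : (∏ j, MvPolynomial.X j ^ m j : MvPolynomial (Fin n) ℤ) =
      MvPolynomial.monomial (Finsupp.equivFunOnFinite.symm m) 1 := by
    rw [MvPolynomial.monomial_eq, Finsupp.prod_fintype _ _ (by simp)]
    simp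
  rw [key, MvPolynomial.coeff_monomial_mul']
  split_ifs
  · simpa using hP _
  · exact le_rfl

theorem IsMultilinear.combine {e : EdgeLabel n → ℕ × ℕ} {x y z : ℕ × ℕ} {f g : CoeffField n}
    (hf : IsMultilinear e y f) (hg : IsMultilinear e z g) (v w : Fin n → ℤ)
    (hv : ∀ i, 0 ≤ v i) (hw : ∀ i, 0 ≤ w i)
    (hvx : ∀ i, v i + (if Crosses (e (Sum.inl i)) y then 1 else 0) ≤
      if Crosses (e (Sum.inl i)) x then 1 else 0)
    (hwx : ∀ i, w i + (if Crosses (e (Sum.inl i)) z then 1 else 0) ≤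
      if Crosses (e (Sum.inl i)) x then 1 else 0) :
    IsMultilinear e x (laurentMonomial v * f + laurentMonomial w * g) := by
  obtain ⟨P, rfl, hP1, hP2, hP3⟩ := hf
  obtain ⟨Q, rfl, hQ1, hQ2, hQ3⟩ := hg
  refine ⟨(∏ i, MvPolynomial.X i ^ (v i).toNat) * P + (∏ i, MvPolynomial.X i ^ (w i).toNat) * Q,
    ?_, fun m => ?_, ?_, fun i => ?_⟩
  · rw [laurentMonomial_eq_monomial v hv, laurentMonomial_eq_monomial w hw]
    simp only [map_add, map_mul]
  · rw [MvPolynomial.coeff_add]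
    exact add_nonneg (coeff_prod_X_pow_mul_nonneg _ hP1 m) (coeff_prod_X_pow_mul_nonneg _ hQ1 m)
  · simpa using add_pos hP2 hQ2
  · refine (MvPolynomial.degreeOf_add_le _ _ _).trans (max_le ?_ ?_)
    · refine (MvPolynomial.degreeOf_mul_le _ _ _).trans ?_
      have h1 := degreeOf_prod_X_pow_le (fun i => (v i).toNat) i
      have h2 := hP3 i
      have h3 := hvx i
      have h4 := hv i
      split_ifs at * <;> omega
    · refine (MvPolynomial.degreeOf_mul_le _ _ _).trans ?_
      have h1 := degreeOf_prod_X_pow_le (fun i => (w i).toNat) i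
      have h2 := hQ3 i
      have h3 := hwx i
      have h4 := hw i
      split_ifs at * <;> omega

theorem isMultilinear_one (e : EdgeLabel n → ℕ × ℕ) (x : ℕ × ℕ) : IsMultilinear e x 1 := by
  refine ⟨1, by simp, fun m => ?_, by simp, fun i => by simp⟩
  rw [MvPolynomial.coeff_one]
  split_ifs <;> simp

/-- A chord outside the triangulation has an endpoint in a triangle whose opposite side it
crosses. -/
theorem IsTriangulation.exists_crossed_triangle {e : EdgeLabel n → ℕ × ℕ} (h : IsTriangulation e)
    {u v : ℕ} (huv : u < v) (hv : v ≤ n + 2) (hmem : (u, v) ∉ Set.range e) :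
    (∃ b d, u < b ∧ b < v ∧ v < d ∧ (u, b) ∈ Set.range e ∧ (u, d) ∈ Set.range e ∧
      (b, d) ∈ Set.range e) ∨
    (∃ a c, a < u ∧ u < c ∧ c < v ∧ (a, u) ∈ Set.range e ∧ (u, c) ∈ Set.range e ∧
      (a, c) ∈ Set.range e) := by
  have hne : u + 1 ≠ v := by
    rintro rfl
    exact hmem (h.succ_mem (by omega))
  by_cases hs : ∃ s, v < s ∧ (u, s) ∈ Set.range e
  · left
    have hmin := fun m => Nat.find_min hs (m := m)
    obtain ⟨h1, h2⟩ := Nat.find_spec hs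
    set d := Nat.find hs
    obtain ⟨b, hb1, hb2, hb3, hb4⟩ := h.exists_inner_apex h2 (by omega)
    have hbv : b ≠ v := by
      rintro rfl
      exact hmem hb3
    have : b < v := by
      by_contra hcon
      exact hmin b hb2 ⟨by omega, hb3⟩
    exact ⟨b, d, hb1, this, h1, hb3, h2, hb4⟩
  · right
    push Not at hs
    obtain ⟨r, hr, hmax⟩ := Finset.exists_max_image
      ((Finset.range v).filter fun r => (u, r) ∈ Set.range e) id
      ⟨u + 1, by
        rw [Finset.mem_filter, Finset.mem_range]
        exact ⟨by omega, h.succ_mem (by omega)⟩⟩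
    simp only [Finset.mem_filter, Finset.mem_range, id] at hr hmax
    rcases h.exists_outer_apex hr.2 (by simp only [ne_eq, Prod.mk.injEq]; omega) with
      ⟨a, h1, h2, h3⟩ | ⟨t, h1, h2, h3⟩
    · exact ⟨a, r, h1, (h.lt_of_mem hr.2).1, hr.1, h2, hr.2, h3⟩
    · exfalso
      rcases lt_trichotomy t v with h4 | rfl | h4
      · have := hmax t ⟨h4, h2⟩
        omega
      · exact hmem h2
      · exact hs t h4 h2

theorem IsTriangulation.exists_inl_of_crosses {e : EdgeLabel n → ℕ × ℕ} (h : IsTriangulation e)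
    {x y : ℕ × ℕ} (hx : x ∈ Set.range e) (hy : y.2 ≤ n + 2) (hc : Crosses x y) :
    ∃ i, e (Sum.inl i) = x := by
  obtain ⟨i | v, rfl⟩ := hx
  · exact ⟨i, rfl⟩
  · exfalso
    rw [h.side] at hc
    simp only [Crosses] at hc
    split_ifs at hc <;> simp only at hc <;> omega

/-- Normalized lambda lengths are polynomials that are linear in each variable. -/
theorem IsNormalizedLength.isMultilinear {e : EdgeLabel n → ℕ × ℕ} (h : IsTriangulation e)
    {F : ℕ × ℕ → CoeffField n} (hF : IsNormalizedLength e F) (u v : ℕ) (huv : u < v)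
    (hv : v ≤ n + 2) : IsMultilinear e (u, v) (F (u, v)) := by
  induction hN : (Finset.univ.filter fun i => Crosses (e (Sum.inl i)) (u, v)).card
    using Nat.strong_induction_on generalizing u v with
  | _ N ih =>
  by_cases hmem : (u, v) ∈ Set.range e
  · rw [hF.eq_one _ hmem]
    exact isMultilinear_one e _
  have descend : ∀ u' v' y, u' < v' → v' ≤ n + 2 → y ∈ Set.range e → Crosses y (u, v) →
      ¬ Crosses y (u', v') →
      (∀ i, Crosses (e (Sum.inl i)) (u', v') → Crosses (e (Sum.inl i)) (u, v)) →
      IsMultilinear e (u', v') (F (u', v')) := by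
    intro u' v' y huv' hv' hy hc hc' hsub
    obtain ⟨i, rfl⟩ := h.exists_inl_of_crosses hy hv hc
    refine ih _ ?_ u' v' huv' hv' rfl
    rw [← hN]
    apply Finset.card_lt_card
    rw [Finset.ssubset_iff_of_subset]
    · exact ⟨i, by simpa using hc, by simpa using hc'⟩
    · intro j
      simpa using hsub j
  have edge : ∀ i, (e (Sum.inl i)).1 < (e (Sum.inl i)).2 := fun i => h.lt _
  have nc : ∀ {x}, x ∈ Set.range e → ∀ i, ¬ Crosses (e (Sum.inl i)) x :=
    fun hx i => h.not_crosses ⟨_, rfl⟩ hx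
  rcases h.exists_crossed_triangle huv hv hmem with
    ⟨b, d, h1, h2, h3, mub, mud, mbd⟩ | ⟨a, c, h1, h2, h3, mau, muc, mac⟩
  · have hd := (h.lt_of_mem mud).2
    have hex := hF.exchange u b v d h1 h2 h3
    rw [hF.eq_one _ mub, hF.eq_one _ mud, hF.eq_one _ mbd, mul_one, mul_one, one_mul] at hex
    rw [hex]
    have s1 : ∀ i, Crosses (e (Sum.inl i)) (b, v) → Crosses (e (Sum.inl i)) (u, v) := by
      intro i
      have := edge i
      have c1 := nc mub i
      have c2 := nc mud i
      have c3 := nc mbd i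
      simp only [Crosses] at *
      omega
    have s2 : ∀ i, Crosses (e (Sum.inl i)) (v, d) → Crosses (e (Sum.inl i)) (u, v) := by
      intro i
      have := edge i
      have c1 := nc mub i
      have c2 := nc mud i
      have c3 := nc mbd i
      simp only [Crosses] at *
      omega
    refine IsMultilinear.combine
      (descend b v (b, d) h2 hv mbd (by simp only [Crosses]; omega)
        (by simp only [Crosses]; omega) s1)
      (descend v d (b, d) h3 hd mbd (by simp only [Crosses]; omega)
        (by simp only [Crosses]; omega) s2) _ _ (fun i => le_max_right _ _)
        (fun i => le_max_right _ _) (fun i => ?_) (fun i => ?_)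
    all_goals
      have := edge i
      have c1 := nc mub i
      have c2 := nc mud i
      have c3 := nc mbd i
      simp only [Crosses, laminationExp] at *
      split_ifs <;> omega
  · have hex := hF.exchange a u c v h1 h2 h3
    rw [hF.eq_one _ mau, hF.eq_one _ muc, hF.eq_one _ mac, one_mul, one_mul, one_mul] at hex
    rw [hex]
    have s1 : ∀ i, Crosses (e (Sum.inl i)) (a, v) → Crosses (e (Sum.inl i)) (u, v) := by
      intro i
      have := edge i
      have c1 := nc mau i
      have c2 := nc muc i
      have c3 := nc mac i
      simp only [Crosses] at *
      omega
    have s2 : ∀ i, Crosses (e (Sum.inl i)) (c, v) → Crosses (e (Sum.inl i)) (u, v) := by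
      intro i
      have := edge i
      have c1 := nc mau i
      have c2 := nc muc i
      have c3 := nc mac i
      simp only [Crosses] at *
      omega
    refine IsMultilinear.combine
      (descend a v (a, c) (by omega) hv mac (by simp only [Crosses]; omega)
        (by simp only [Crosses]; omega) s1)
      (descend c v (a, c) h3 hv mac (by simp only [Crosses]; omega)
        (by simp only [Crosses]; omega) s2) _ _ (fun i => le_max_right _ _)
        (fun i => le_max_right _ _) (fun i => ?_) (fun i => ?_)
    all_goals
      have := edge i
      have c1 := nc mau i
      have c2 := nc muc i
      have c3 := nc mac i
      simp only [Crosses, laminationExp] at *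
      split_ifs <;> omega

namespace HasValueAtOne

variable {z z' : AmbientField n} {v v' : CoeffField n}

theorem algebraMap_ne_zero {D : MvPolynomial (Fin n) (CoeffField n)}
    (h : MvPolynomial.eval (fun _ => 1) D ≠ 0) : algebraMap _ (AmbientField n) D ≠ 0 := by
  rw [Ne, IsFractionRing.to_map_eq_zero_iff]
  rintro rfl
  simp at h

theorem of_polynomial (N : MvPolynomial (Fin n) (CoeffField n)) :
    HasValueAtOne (algebraMap _ (AmbientField n) N) (MvPolynomial.eval (fun _ => 1) N) :=
  ⟨N, 1, by simp, by simp, by simp⟩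

theorem toAmbient (a : Trop n) : HasValueAtOne a.toAmbient a.toCoeff := by
  have := of_polynomial (MvPolynomial.C a.toCoeff)
  rwa [MvPolynomial.eval_C] at this

theorem add (h : HasValueAtOne z v) (h' : HasValueAtOne z' v') :
    HasValueAtOne (z + z') (v + v') := by
  obtain ⟨N, D, hD, rfl, rfl⟩ := h
  obtain ⟨N', D', hD', rfl, rfl⟩ := h'
  refine ⟨N * D' + D * N', D * D', ?_, ?_, ?_⟩
  · simpa using ⟨hD, hD'⟩
  · rw [div_add_div _ _ (algebraMap_ne_zero hD) (algebraMap_ne_zero hD')]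
    simp only [map_add, map_mul]
  · rw [div_add_div _ _ hD hD']
    simp only [map_add, map_mul]

theorem mul (h : HasValueAtOne z v) (h' : HasValueAtOne z' v') :
    HasValueAtOne (z * z') (v * v') := by
  obtain ⟨N, D, hD, rfl, rfl⟩ := h
  obtain ⟨N', D', hD', rfl, rfl⟩ := h'
  refine ⟨N * N', D * D', ?_, ?_, ?_⟩
  · simpa using ⟨hD, hD'⟩
  · rw [div_mul_div_comm]
    simp only [map_mul]
  · rw [div_mul_div_comm]
    simp only [map_mul]

theorem inv (h : HasValueAtOne z v) (hv : v ≠ 0) : HasValueAtOne z⁻¹ v⁻¹ := by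
  obtain ⟨N, D, hD, rfl, rfl⟩ := h
  refine ⟨D, N, fun h0 => hv (by rw [h0, zero_div]), inv_div _ _, inv_div _ _⟩

theorem one : HasValueAtOne (1 : AmbientField n) 1 := by
  simpa using of_polynomial (1 : MvPolynomial (Fin n) (CoeffField n))

theorem pow (h : HasValueAtOne z v) (m : ℕ) : HasValueAtOne (z ^ m) (v ^ m) := by
  induction m with
  | zero => simpa using one
  | succ m ih =>
    rw [pow_succ, pow_succ]
    exact ih.mul h

theorem zpow (h : HasValueAtOne z v) {m : ℤ} (hm : 0 ≤ m) : HasValueAtOne (z ^ m) (v ^ m) := by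
  lift m to ℕ using hm
  simpa using h.pow m

theorem prod {ι : Type*} (s : Finset ι) {f : ι → AmbientField n} {g : ι → CoeffField n}
    (h : ∀ i ∈ s, HasValueAtOne (f i) (g i)) :
    HasValueAtOne (∏ i ∈ s, f i) (∏ i ∈ s, g i) := by
  induction s using Finset.induction_on with
  | empty => simpa using one
  | insert a s ha ih =>
    rw [Finset.prod_insert ha, Finset.prod_insert ha]
    exact (h a (Finset.mem_insert_self a s)).mul
      (ih fun i hi => h i (Finset.mem_insert_of_mem hi))

theorem unique (h : HasValueAtOne z v) (h' : HasValueAtOne z v') : v = v' := by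
  obtain ⟨N, D, hD, rfl, rfl⟩ := h
  obtain ⟨N', D', hD', hz, rfl⟩ := h'
  rw [div_eq_div_iff (algebraMap_ne_zero hD) (algebraMap_ne_zero hD'), ← map_mul, ← map_mul] at hz
  have := congrArg (MvPolynomial.eval fun _ => 1)
    (IsFractionRing.injective _ (AmbientField n) hz)
  rw [div_eq_div_iff hD hD']
  simpa using this

end HasValueAtOne

/-- The exponent vectors of the coefficients attached to the edges of the triangulation `e` with
respect to the initial triangulation `e₀`. -/
def shearExp (e₀ e : EdgeLabel n → ℕ × ℕ) (k : EdgeLabel n) (l : Fin n) : ℤ :=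
  ∑ j, adjMatrix e j k * laminationExp e₀ (e j) l

/-- The two positive and the two negative entries in the column of a flipped diagonal, and the
resulting exchange relations. -/
theorem IsFlip.exists_exchange {e₀ e e' : EdgeLabel n → ℕ × ℕ} {k : Fin n} {a b c d : ℕ}
    (h : IsFlip e e' k a b c d) {F : ℕ × ℕ → CoeffField n} (hF : IsNormalizedLength e₀ F) :
    ∃ p p' q q', p ∈ Set.range e ∧ p' ∈ Set.range e ∧ q ∈ Set.range e ∧ q' ∈ Set.range e ∧
      p ≠ p' ∧ q ≠ q' ∧
      (∀ j, max (adjMatrix e j (Sum.inl k)) 0 = if e j = p ∨ e j = p' then 1 else 0) ∧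
      (∀ j, max (- adjMatrix e j (Sum.inl k)) 0 = if e j = q ∨ e j = q' then 1 else 0) ∧
      (∀ l, laminationExp e₀ (e (Sum.inl k)) l + laminationExp e₀ (e' (Sum.inl k)) l =
        min (laminationExp e₀ p l + laminationExp e₀ p' l)
          (laminationExp e₀ q l + laminationExp e₀ q' l)) ∧
      F (e (Sum.inl k)) * F (e' (Sum.inl k)) =
        laurentMonomial (fun i => max (laminationExp e₀ p i + laminationExp e₀ p' i -
          (laminationExp e₀ q i + laminationExp e₀ q' i)) 0) * (F p * F p') +
        laurentMonomial (fun i => max (laminationExp e₀ q i + laminationExp e₀ q' i -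
          (laminationExp e₀ p i + laminationExp e₀ p' i)) 0) * (F q * F q') := by
  obtain ⟨m1, m2, m3, m4⟩ := h.mem_range
  have h1 := h.quad.ab
  have h2 := h.quad.bc
  have h3 := h.quad.cd
  have n1 : (b, c) ≠ (a, d) := by simp only [ne_eq, Prod.mk.injEq]; omega
  have n2 : (a, b) ≠ (c, d) := by simp only [ne_eq, Prod.mk.injEq]; omega
  have pt := laminationExp_ptolemy e₀ h1 h2 h3
  have ex := hF.exchange a b c d h1 h2 h3
  rcases h.diag with ⟨hk, hk'⟩ | ⟨hk, hk'⟩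
  · refine ⟨(b, c), (a, d), (a, b), (c, d), m2, m4, m1, m3, n1, n2,
      fun j => (h.max_adjMatrix_of_ac hk j).1, fun j => (h.max_adjMatrix_of_ac hk j).2, ?_, ?_⟩
    · rw [hk, hk']; exact pt
    · rw [hk, hk']; exact ex
  · refine ⟨(a, b), (c, d), (b, c), (a, d), m1, m3, m2, m4, n2, n1,
      fun j => (h.max_adjMatrix_of_bd hk j).1, fun j => (h.max_adjMatrix_of_bd hk j).2, ?_, ?_⟩
    · intro l
      rw [hk, hk', add_comm, pt, min_comm]
    · rw [hk, hk', mul_comm, ex, add_comm]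

theorem sum_ite_mul_eq {e : EdgeLabel n → ℕ × ℕ} (he : Function.Injective e) (g : ℕ × ℕ → ℤ)
    {p q : ℕ × ℕ} (hp : p ∈ Set.range e) (hq : q ∈ Set.range e) (hpq : p ≠ q) :
    ∑ j, (if e j = p ∨ e j = q then 1 else 0) * g (e j) = g p + g q := by
  rw [← sum_ite_eq_or_eq he g hp hq hpq]
  refine Finset.sum_congr rfl fun j _ => ?_
  split_ifs <;> simp

theorem sum_mul_eq_sub_max {J : Type*} [Fintype J] (f M : J → ℤ) :
    ∑ j, f j * M j = ∑ j, max (f j) 0 * M j - ∑ j, max (- f j) 0 * M j := by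
  rw [← Finset.sum_sub_distrib]
  refine Finset.sum_congr rfl fun j _ => ?_
  have : f j = max (f j) 0 - max (- f j) 0 := by omega
  rw [← sub_mul, ← this]

/-- The tropical form of the mutation rule for coefficients, for the exponents
`∑ i, b i j * M i`. -/
theorem sum_mutate {J : Type*} [Fintype J] (b : J → J → ℤ) (k : J) (M M' : J → ℤ)
    (hM : ∀ j ≠ k, M' j = M j) (hb : b k k = 0)
    (hk : M k + M' k = min (∑ i, max (b i k) 0 * M i) (∑ i, max (- b i k) 0 * M i))
    (j : J) (hj : j ≠ k) :
    ∑ i, (if i = k ∨ j = k then - b i j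
      else b i j + max (b i k) 0 * b k j + b i k * max (- b k j) 0) * M' i =
    ∑ i, b i j * M i + max (b k j) 0 * ∑ i, b i k * M i +
      (- b k j) * min 0 (∑ i, b i k * M i) := by
  have hC := sum_mul_eq_sub_max (fun i => b i k) M
  set P := ∑ i, max (b i k) 0 * M i with hP
  set Q := ∑ i, max (- b i k) 0 * M i with hQ
  set C := ∑ i, b i k * M i with hCdef
  have key : ∀ i, (if i = k ∨ j = k then - b i j
      else b i j + max (b i k) 0 * b k j + b i k * max (- b k j) 0) * M' i =
      (b i j * M i + b k j * (max (b i k) 0 * M i) + max (- b k j) 0 * (b i k * M i)) -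
        if i = k then b k j * (M k + M' k) else 0 := by
    intro i
    by_cases hi : i = k
    · subst hi
      simp [hb]
      ring
    · rw [if_neg (by tauto), if_neg hi, hM i hi]
      ring
  rw [Finset.sum_congr rfl fun i _ => key i, Finset.sum_sub_distrib, Finset.sum_add_distrib,
    Finset.sum_add_distrib, ← Finset.mul_sum, ← Finset.mul_sum, ← hP, ← hCdef,
    Finset.sum_ite_eq' Finset.univ k, if_pos (Finset.mem_univ k), hk]
  have e1 : min P Q = Q + min 0 C := by omega
  have e2 : max (- b k j) 0 = max (b k j) 0 - b k j := by omega
  rw [e1, e2, show P = C + Q by omega]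
  ring

/-- The seed `s` is the one attached to the triangulation `e`, when the initial seed is attached to
`e₀`. -/
structure IsSeedOf (e₀ e : EdgeLabel n → ℕ × ℕ) (F : ℕ × ℕ → CoeffField n) (s : Seed n) :
    Prop where
  tri : IsTriangulation e
  matrix : ∀ i j, s.B i j = adjMatrix e (Sum.inl i) (Sum.inl j)
  coeff : ∀ k, s.y k = Multiplicative.ofAdd (shearExp e₀ e (Sum.inl k))
  value : ∀ i, HasValueAtOne (s.x i) (F (e (Sum.inl i)))

theorem isSeedOf_initialSeed {e : EdgeLabel n → ℕ × ℕ} (he : IsTriangulation e)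
    {F : ℕ × ℕ → CoeffField n} (hF : IsNormalizedLength e F) {B : Matrix (Fin n) (Fin n) ℤ}
    (hB : ∀ i j, B i j = adjMatrix e (Sum.inl i) (Sum.inl j)) :
    IsSeedOf e e F (initialSeed B) := by
  refine ⟨he, hB, fun k => ?_, fun i => ?_⟩
  · obtain ⟨e', a, b, c, d, -, hf⟩ := he.exists_flip k
    obtain ⟨m1, m2, m3, m4⟩ := hf.mem_range
    have h1 := hf.quad.ab
    have h2 := hf.quad.bc
    have h3 := hf.quad.cd
    have n1 : (b, c) ≠ (a, d) := by simp only [ne_eq, Prod.mk.injEq]; omega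
    have n2 : (a, b) ≠ (c, d) := by simp only [ne_eq, Prod.mk.injEq]; omega
    simp only [initialSeed, Trop.gen]
    congr 1
    funext l
    rw [shearExp, sum_mul_eq_sub_max]
    have c1 := he.not_crosses ⟨Sum.inl l, rfl⟩ m1
    have c2 := he.not_crosses ⟨Sum.inl l, rfl⟩ m2
    have c3 := he.not_crosses ⟨Sum.inl l, rfl⟩ m3
    have c4 := he.not_crosses ⟨Sum.inl l, rfl⟩ m4
    have c5 := he.noncrossing (Sum.inl l) (Sum.inl k)
    have hl := he.lt (Sum.inl l)
    have hlk : l = k ↔ e (Sum.inl l) = e (Sum.inl k) := by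
      rw [he.inj.eq_iff, Sum.inl.injEq]
    rw [Pi.single_apply]
    simp only [hlk]
    rcases hf.diag with ⟨hk, -⟩ | ⟨hk, -⟩
    · simp only [fun j => (hf.max_adjMatrix_of_ac hk j).1, fun j => (hf.max_adjMatrix_of_ac hk j).2]
      rw [sum_ite_mul_eq he.inj (fun x => laminationExp e x l) m2 m4 n1,
        sum_ite_mul_eq he.inj (fun x => laminationExp e x l) m1 m3 n2, hk]
      rw [hk] at c5
      simp only [laminationExp]
      generalize e (Sum.inl l) = x at *
      obtain ⟨p, q⟩ := x
      simp only [Crosses, Prod.mk.injEq] at *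
      split_ifs <;> omega
    · simp only [fun j => (hf.max_adjMatrix_of_bd hk j).1, fun j => (hf.max_adjMatrix_of_bd hk j).2]
      rw [sum_ite_mul_eq he.inj (fun x => laminationExp e x l) m2 m4 n1,
        sum_ite_mul_eq he.inj (fun x => laminationExp e x l) m1 m3 n2, hk]
      rw [hk] at c5
      simp only [laminationExp]
      generalize e (Sum.inl l) = x at *
      obtain ⟨p, q⟩ := x
      simp only [Crosses, Prod.mk.injEq] at *
      split_ifs <;> omega
  · rw [hF.eq_one _ ⟨_, rfl⟩]
    simpa [initialSeed] using
      HasValueAtOne.of_polynomial (MvPolynomial.X i : MvPolynomial (Fin n) (CoeffField n))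

theorem IsMultilinear.ne_zero {e : EdgeLabel n → ℕ × ℕ} {x : ℕ × ℕ} {z : CoeffField n}
    (h : IsMultilinear e x z) : z ≠ 0 := by
  obtain ⟨P, rfl, -, hP, -⟩ := h
  rw [Ne, IsFractionRing.to_map_eq_zero_iff]
  rintro rfl
  simp at hP

theorem prod_zpow_eq {e₀ e : EdgeLabel n → ℕ × ℕ} (h₀ : IsTriangulation e₀)
    (h : IsTriangulation e) {F : ℕ × ℕ → CoeffField n} (hF : IsNormalizedLength e₀ F)
    (f : EdgeLabel n → ℤ) {p q : ℕ × ℕ} (hp : p ∈ Set.range e) (hq : q ∈ Set.range e)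
    (hpq : p ≠ q) (hf : ∀ j, f j = if e j = p ∨ e j = q then 1 else 0) :
    ∏ j : Fin n, F (e (Sum.inl j)) ^ f (Sum.inl j) = F p * F q := by
  have hside : ∀ v, F (e (Sum.inr v)) = 1 := by
    intro v
    rw [h.side, ← h₀.side]
    exact hF.eq_one _ ⟨_, rfl⟩
  have : ∏ j, F (e j) ^ f j = ∏ j : Fin n, F (e (Sum.inl j)) ^ f (Sum.inl j) := by
    rw [Fintype.prod_sum_type]
    simp [hside]
  rw [← this, ← prod_ite_eq_or_eq h.inj F hp hq hpq]
  refine Finset.prod_congr rfl fun j _ => ?_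
  rw [hf]
  split_ifs <;> simp

theorem IsSeedOf.mutate {e₀ e : EdgeLabel n → ℕ × ℕ} (h₀ : IsTriangulation e₀)
    {F : ℕ × ℕ → CoeffField n} (hF : IsNormalizedLength e₀ F) {s : Seed n}
    (hs : IsSeedOf e₀ e F s) (k : Fin n) : ∃ e', IsSeedOf e₀ e' F (s.mutate k) := by
  obtain ⟨e', a, b, c, d, he', hf⟩ := hs.tri.exists_flip k
  obtain ⟨p, p', q, q', hp, hp', hq, hq', hpp, hqq, hpos, hneg, htrop, hexch⟩ :=
    hf.exists_exchange hF
  have hP : ∀ l, ∑ j, max (adjMatrix e j (Sum.inl k)) 0 * laminationExp e₀ (e j) l =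
      laminationExp e₀ p l + laminationExp e₀ p' l := by
    intro l
    simp only [hpos]
    exact sum_ite_mul_eq hs.tri.inj (fun x => laminationExp e₀ x l) hp hp' hpp
  have hQ : ∀ l, ∑ j, max (- adjMatrix e j (Sum.inl k)) 0 * laminationExp e₀ (e j) l =
      laminationExp e₀ q l + laminationExp e₀ q' l := by
    intro l
    simp only [hneg]
    exact sum_ite_mul_eq hs.tri.inj (fun x => laminationExp e₀ x l) hq hq' hqq
  have hshear : ∀ l, shearExp e₀ e (Sum.inl k) l = laminationExp e₀ p l + laminationExp e₀ p' l -
      (laminationExp e₀ q l + laminationExp e₀ q' l) := by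
    intro l
    rw [shearExp, sum_mul_eq_sub_max, hP, hQ]
  have hFe : F (e (Sum.inl k)) ≠ 0 :=
    (hF.isMultilinear h₀ _ _ (hs.tri.lt _) (hs.tri.le _)).ne_zero
  refine ⟨e', he', mutateMatrix_eq_of_flip hf hs.matrix, fun i => ?_, fun i => ?_⟩
  · by_cases hi : i = k
    · subst hi
      simp only [Seed.mutate, if_true]
      rw [hs.coeff, ← ofAdd_neg]
      congr 1
      funext l
      simp only [Pi.neg_apply, shearExp]
      rw [← Finset.sum_neg_distrib]
      refine Finset.sum_congr rfl fun j _ => ?_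
      rw [hf.adjMatrix_mutate, if_pos (Or.inr rfl)]
      by_cases hj : j = Sum.inl i
      · subst hj
        simp [adjMatrix, adjacency_self]
      · rw [hf.eq_off j hj, neg_mul]
    · simp only [Seed.mutate, if_neg hi]
      rw [hs.coeff, hs.coeff, hs.matrix]
      apply Multiplicative.toAdd.injective
      funext l
      simp only [toAdd_mul, toAdd_zpow, toAdd_ofAdd, Trop.oplus, toAdd_one, Pi.add_apply,
        Pi.smul_apply, smul_eq_mul, Pi.zero_apply]
      have hne : (Sum.inl i : EdgeLabel n) ≠ Sum.inl k := by simpa using hi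
      have key := sum_mutate (adjMatrix e) (Sum.inl k) (fun j => laminationExp e₀ (e j) l)
        (fun j => laminationExp e₀ (e' j) l) (fun j hj => by simp only [hf.eq_off j hj])
        (adjacency_self _ _) (by rw [hP, hQ]; exact htrop l) (Sum.inl i) hne
      simp only [shearExp, hf.adjMatrix_mutate]
      convert key.symm
  · by_cases hi : i = k
    · subst hi
      simp only [Seed.mutate, if_true]
      have e1 : Trop.toCoeff (s.y i / Trop.oplus 1 (s.y i)) =
          laurentMonomial (fun l => max (laminationExp e₀ p l + laminationExp e₀ p' l -
            (laminationExp e₀ q l + laminationExp e₀ q' l)) 0) := by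
        rw [laurentMonomial]
        congr 1
        apply Multiplicative.toAdd.injective
        funext l
        rw [hs.coeff]
        simp only [toAdd_div, toAdd_ofAdd, Trop.oplus, toAdd_one, Pi.sub_apply, Pi.zero_apply,
          hshear l]
        omega
      have e2 : Trop.toCoeff (1 / Trop.oplus 1 (s.y i)) =
          laurentMonomial (fun l => max (laminationExp e₀ q l + laminationExp e₀ q' l -
            (laminationExp e₀ p l + laminationExp e₀ p' l)) 0) := by
        rw [laurentMonomial]
        congr 1
        apply Multiplicative.toAdd.injective
        funext l
        rw [hs.coeff]
        simp only [toAdd_div, toAdd_ofAdd, Trop.oplus, toAdd_one, Pi.sub_apply, Pi.zero_apply,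
          hshear l]
        omega
      have main := ((hs.value i).inv hFe).mul
        (((HasValueAtOne.toAmbient (s.y i / Trop.oplus 1 (s.y i))).mul
          (HasValueAtOne.prod Finset.univ fun j _ =>
            (hs.value j).zpow (le_max_right (s.B j i) 0))).add
        ((HasValueAtOne.toAmbient (1 / Trop.oplus 1 (s.y i))).mul
          (HasValueAtOne.prod Finset.univ fun j _ =>
            (hs.value j).zpow (le_max_right (- s.B j i) 0))))
      convert main using 1
      simp only [hs.matrix]
      rw [prod_zpow_eq h₀ hs.tri hF (fun j => max (adjMatrix e j (Sum.inl i)) 0) hp hp' hpp hpos,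
        prod_zpow_eq h₀ hs.tri hF (fun j => max (- adjMatrix e j (Sum.inl i)) 0) hq hq' hqq hneg,
        e1, e2, ← hexch, inv_mul_cancel_left₀ hFe]
    · simp only [Seed.mutate, if_neg hi]
      rw [hf.eq_off (Sum.inl i) (by simpa using hi)]
      exact hs.value i

theorem exists_isSeedOf_seedAt {e₀ : EdgeLabel n → ℕ × ℕ} (h₀ : IsTriangulation e₀)
    {F : ℕ × ℕ → CoeffField n} (hF : IsNormalizedLength e₀ F) {B : Matrix (Fin n) (Fin n) ℤ}
    (hB : ∀ i j, B i j = adjMatrix e₀ (Sum.inl i) (Sum.inl j)) (w : List (Fin n)) :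
    ∃ e, IsSeedOf e₀ e F (seedAt B w) := by
  induction w using List.reverseRecOn with
  | nil => exact ⟨e₀, isSeedOf_initialSeed h₀ hF hB⟩
  | append_singleton w k ih =>
    obtain ⟨e, he⟩ := ih
    rw [seedAt_append]
    exact he.mutate h₀ hF k

/-- The `F`-polynomials of type `A` are multilinear polynomials with nonnegative coefficients. -/
theorem exists_isFPolynomial {B : Matrix (Fin n) (Fin n) ℤ} (hB : IsSkewSymmetrizable B)
    (hA : IsTypeA B) (w : List (Fin n)) (i : Fin n) :
    ∃ P : MvPolynomial (Fin n) ℤ, IsFPolynomial B w i P ∧ P ≠ 0 ∧ (∀ m, 0 ≤ P.coeff m) ∧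
      ∀ j, P.degreeOf j ≤ 1 := by
  obtain ⟨e₀, h₀, hB₀⟩ := hA.isPolygonMatrix hB
  obtain ⟨F, hF⟩ := h₀.exists_normalizedLength
  obtain ⟨e, he⟩ := exists_isSeedOf_seedAt h₀ hF hB₀ w
  have hm := hF.isMultilinear h₀ _ _ (he.tri.lt (Sum.inl i)) (he.tri.le (Sum.inl i))
  have hne := hm.ne_zero
  obtain ⟨P, hP, hcoeff, -, hdeg⟩ := hm
  refine ⟨P, ?_, ?_, hcoeff, fun j => (hdeg j).trans (by split_ifs <;> simp)⟩
  · rw [IsFPolynomial, ← hP]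
    exact he.value i
  · rintro rfl
    exact hne (by rw [hP, map_zero])

/-- A nonzero multilinear polynomial with nonnegative coefficients is log-concave. -/
theorem isLogConcave_of_degreeOf_le_one {f : MvPolynomial (Fin n) ℝ} (hf : f ≠ 0)
    (hcoeff : ∀ m, 0 ≤ f.coeff m) (hdeg : ∀ j, f.degreeOf j ≤ 1) : IsLogConcave f := by
  refine ⟨hf, hcoeff, fun j a => ?_⟩
  have hzero : intCoeff f (a - Pi.single j 1) * intCoeff f (a + Pi.single j 1) = 0 := by
    by_cases ha : 1 ≤ a j
    · apply mul_eq_zero_of_right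
      rw [intCoeff]
      split_ifs
      · by_contra hne
        have := (MvPolynomial.monomial_le_degreeOf j (MvPolynomial.mem_support_iff.2 hne)).trans
          (hdeg j)
        simp only [Finsupp.coe_equivFunOnFinite_symm, Pi.add_apply, Pi.single_eq_same] at this
        omega
      · rfl
    · apply mul_eq_zero_of_left
      rw [intCoeff, if_neg]
      intro h
      have := h j
      simp only [Pi.sub_apply, Pi.single_eq_same] at this
      omega
  rw [hzero]
  exact sq_nonneg _

end Cluster

end

theorem theorem6p6 (n : ℕ) (B : Matrix (Fin n) (Fin n) ℤ)
    (hB : Cluster.IsSkewSymmetrizable B) (hA : Cluster.IsTypeA B)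
    (w : List (Fin n)) (i : Fin n) :
    (∃! F : MvPolynomial (Fin n) ℤ, Cluster.IsFPolynomial B w i F) ∧
    ∀ F : MvPolynomial (Fin n) ℤ, Cluster.IsFPolynomial B w i F →
      Cluster.IsLogConcave (MvPolynomial.map (Int.castRingHom ℝ) F) ∧
      ∀ j : Fin n, F.degreeOf j ≤ 1 := by
  obtain ⟨P, hP, hne, hcoeff, hdeg⟩ := Cluster.exists_isFPolynomial hB hA w i
  have huniq : ∀ F, Cluster.IsFPolynomial B w i F → F = P := fun F hF =>
    IsFractionRing.injective _ (Cluster.CoeffField n) (Cluster.HasValueAtOne.unique hF hP)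
  refine ⟨⟨P, hP, huniq⟩, fun F hF => ?_⟩
  obtain rfl := huniq F hF
  have hinj : Function.Injective (Int.castRingHom ℝ) := Int.cast_injective
  refine ⟨Cluster.isLogConcave_of_degreeOf_le_one ?_ (fun m => ?_) (fun j => ?_), hdeg⟩
  · rwa [Ne, map_eq_zero_iff _ (MvPolynomial.map_injective _ hinj)]
  · rw [MvPolynomial.coeff_map]
    exact Int.cast_nonneg (hcoeff m)
  · rw [MvPolynomial.degreeOf_le_iff]
    exact fun m hm => MvPolynomial.degreeOf_le_iff.1 (hdeg j) m
      (MvPolynomial.support_map_subset _ _ hm)
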